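/- Let $1<\beta\le 2$ and let $\tau(x)=\beta x-\lfloor\beta x\rfloor$ on $[0,1]$, with greedy digits $g_n(x)=\lfloor\beta\tau^{n-1}(x)\rfloor$ ($n\ge 1$). Call $x\in[0,1]$ simple if $\beta\tau^{n-1}(x)$ is a positive integer for some $n\ge1$, and let $S(x)$ be the least such $n$. Let $X_\beta\subset\{0,1\}^{\mathbb N}$ be the closure, in the product topology, of the set of sequences $(g_n(x))_{n\ge1}$ with $x\in[0,1]$ not simple; order $X_\beta$ lexicographically and let $\sigma$ be the left shift on $X_\beta$. Let $(q_n)_{n\ge1}$ be the quasi-greedy expansion of $1$: $q_n=g_n(1)$ if $1$ is not simple, and $(q_n)$ is the infinite repetition of the word $g_1(1)\cdots g_{S(1)-1}(1)\,(g_{S(1)}(1)-1)$ if $1$ is simple. Let $BV$ be the space of functions $f:X_\beta\to\mathbb C$ of finite total variation $\operatorname{var}(f)$ with respect to the lexicographic order, with norm $\|f\|_{BV}=\sup|f|+\operatorname{var}(f)$; let $\mathcal N\subset BV$ be the closed subspace of functions vanishing off a countable set, let $\mathcal B=BV/\mathcal N$ carry the quotient norm, and let $\mathcal F\subset\mathcal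 B$ be the closure of the linear span of the classes of indicator functions of intervals of $X_\beta$. Let $C_1=\{x\in X_\beta: x_1=1\}$. For $t\in\mathbb R$ let $\mathcal L_t:\mathcal F\to\mathcal F$ be the bounded operator induced by $$\mathcal L_tf(x)=\sum_{y\in X_\beta,\ \sigma(y)=x}e^{t\chi_{C_1}(y)}f(y),$$ and put $$r_t=\limsup_{n\to\infty}\Bigl(\exp\sup_{x\in X_\beta}\sum_{i=0}^{n-1}t\chi_{C_1}(\sigma^ix)\Bigr)^{1/n},\qquad \phi_t(z)=\sum_{n=1}^{\infty}q_n\exp\Bigl(t\sum_{i=1}^{n-1}q_i\Bigr)z^n .$$ Let $t\in\mathbb R$ and let $\lambda\in\mathbb C$ with $|\lambda|>r_t$. Then the series $\phi_t(\lambda^{-1})$ converges absolutely, and $\lambda$ is an isolated eigenvalue of $\mathcal L_t$ (an eigenvalue that is an isolated point of the spectrum of $\mathcal L_t$ on $\mathcal F$) if and only if $\lambda^{-1}$ is a zero of $1-\phi_t(z)$. -/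

import Mathlib

namespace BetaTransfer

open Filter Topology

/-- The beta-map `τ(x) = βx - [βx]`. -/
noncomputable def tau (β x : ℝ) : ℝ := β * x - (⌊β * x⌋₊ : ℝ)

/-- `digit β x n` is the greedy digit `g_{n+1}(x) = [β τ^n(x)]`. -/
noncomputable def digit (β x : ℝ) (n : ℕ) : ℕ := ⌊β * (tau β)^[n] x⌋₊

/-- `x` is simple: for some `n`, the number `β τ^n(x)` is a positive integer. For `1 < β < 2`
and `x ∈ [0,1]` that integer can only be `1`, so this says `τ^n(x) = 1/β`; for `β = 2` the only
additional simple number is `x = 1`, for which `β x = 2`. -/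
abbrev IsSimple (β x : ℝ) : Prop := ∃ n k : ℕ, 1 ≤ k ∧ β * (tau β)^[n] x = k

open Classical in
/-- `quasiGreedyOne β n` is the coefficient `q_{n+1}(1)` of the quasi-greedy expansion of `1`:
the greedy digits if `1` is not simple, and the periodic repetition of
`g_1(1) ⋯ g_{S-1}(1) (g_S(1) - 1)` if `1` is simple, where `S = S(1)` is `Nat.find h + 1`. -/
noncomputable def quasiGreedyOne (β : ℝ) (n : ℕ) : ℕ :=
  if h : IsSimple β 1 then
    if n % (Nat.find h + 1) = Nat.find h then digit β 1 (Nat.find h) - 1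
    else digit β 1 (n % (Nat.find h + 1))
  else digit β 1 n

/-- The image of the coding map: greedy digit sequences of the non-simple points of `[0,1]`. -/
def coded (β : ℝ) : Set (ℕ → Fin 2) :=
  {ω | ∃ x : ℝ, 0 ≤ x ∧ x ≤ 1 ∧ ¬ IsSimple β x ∧ ∀ n, (ω n : ℕ) = digit β x n}

/-- The beta-shift as a subset of `{0,1}^ℕ` (product topology). -/
def shiftSet (β : ℝ) : Set (ℕ → Fin 2) := closure (coded β)

/-- The beta-shift `X_β`. -/
@[ext]
structure Shift (β : ℝ) : Type where
  /-- the sequence of digits, starting at index `0` -/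
  seq : ℕ → Fin 2
  mem : seq ∈ shiftSet β

/-- The lexicographic order on `X_β`. -/
noncomputable instance (β : ℝ) : LinearOrder (Shift β) :=
  LinearOrder.lift' (fun x : Shift β => toLex x.1) fun _ _ h => Shift.ext (toLex.injective h)

theorem lt_def {β : ℝ} {x y : Shift β} :
    x < y ↔ ∃ n, (∀ m < n, x.1 m = y.1 m) ∧ x.1 n < y.1 n := Iff.rfl

theorem tau_nonneg {β x : ℝ} (h : 0 ≤ β * x) : 0 ≤ tau β x :=
  sub_nonneg.2 (Nat.floor_le h)

theorem tau_lt_one (β x : ℝ) : tau β x < 1 := by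
  have := Nat.lt_floor_add_one (β * x)
  unfold tau; linarith

theorem not_isSimple_tau {β x : ℝ} (h : ¬ IsSimple β x) : ¬ IsSimple β (tau β x) := by
  rintro ⟨n, k, hk, e⟩
  exact h ⟨n + 1, k, hk, by rwa [Function.iterate_succ_apply]⟩

theorem digit_tau (β x : ℝ) (n : ℕ) : digit β (tau β x) n = digit β x (n + 1) := by
  rw [digit, digit, Function.iterate_succ_apply]

theorem mapsTo_shift_coded {β : ℝ} (hβ : 1 < β) {ω : ℕ → Fin 2} (h : ω ∈ coded β) :
    (fun n => ω (n + 1)) ∈ coded β := by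
  obtain ⟨x, h0, -, hs, hd⟩ := h
  exact ⟨tau β x, tau_nonneg (by positivity), (tau_lt_one β x).le, not_isSimple_tau hs,
    fun n => by rw [hd, digit_tau]⟩

theorem shift_mem {β : ℝ} (hβ : 1 < β) {ω : ℕ → Fin 2} (h : ω ∈ shiftSet β) :
    (fun n => ω (n + 1)) ∈ shiftSet β := by
  have hc : Continuous fun ω : ℕ → Fin 2 => fun n => ω (n + 1) := by fun_prop
  have hm : Set.MapsTo (fun ω : ℕ → Fin 2 => fun n => ω (n + 1)) (coded β) (coded β) :=
    fun _ => mapsTo_shift_coded hβ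
  exact hm.closure hc h

/-- The left shift `σ : X_β → X_β`. -/
def shift {β : ℝ} (hβ : 1 < β) (x : Shift β) : Shift β :=
  ⟨fun n => x.1 (n + 1), shift_mem hβ x.2⟩

/-- The sequence `jx`. -/
def cons (j : Fin 2) (ω : ℕ → Fin 2) : ℕ → Fin 2
  | 0 => j
  | n + 1 => ω n

/-- Prepending a digit to a coded point. -/
theorem cons_coded {β u : ℝ} (hβ : 1 < β) (j : Fin 2) (h0 : 0 ≤ u) (h1 : u < 1)
    (hs : ¬ IsSimple β u) (hj : u = 0 → j = 0) :
    ¬ IsSimple β ((u + (j : ℕ)) / β) ∧ tau β ((u + (j : ℕ)) / β) = u ∧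
      digit β ((u + (j : ℕ)) / β) 0 = j := by
  have hb : β ≠ 0 := by positivity
  have e : β * ((u + (j : ℕ)) / β) = u + (j : ℕ) := by field_simp
  have f : ⌊u + (j : ℕ)⌋₊ = j := by
    rw [Nat.floor_add_natCast h0, Nat.floor_eq_zero.2 h1, zero_add]
  have ht : tau β ((u + (j : ℕ)) / β) = u := by rw [tau, e, f]; ring
  refine ⟨?_, ht, by rw [digit, Function.iterate_zero, id, e, f]⟩
  rintro ⟨n, k, hk, h⟩
  cases n with
  | zero =>
    rw [Function.iterate_zero, id, e] at h
    have : (j : ℕ) = k := by rw [← f, h, Nat.floor_natCast]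
    have hu : u = 0 := by rw [← this] at h; linarith
    rw [hj hu] at this
    simp at this; omega
  | succ n =>
    rw [Function.iterate_succ_apply, ht] at h
    exact hs ⟨n, k, hk, h⟩

/-- The coding map reflects strict inequalities. -/
theorem lt_of_digit_lt {β u p : ℝ} (hβ : 1 < β) {n : ℕ}
    (he : ∀ m < n, digit β u m = digit β p m) (hl : digit β u n < digit β p n) : u < p := by
  by_contra! hle
  have key : ∀ m ≤ n, (tau β)^[m] p ≤ (tau β)^[m] u := by
    intro m
    induction m with
    | zero => intro _; simpa using hle
    | succ m ih =>
      intro hm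
      have h1 := ih (by omega)
      have h2 := he m (by omega)
      rw [Function.iterate_succ_apply', Function.iterate_succ_apply']
      rw [digit, digit] at h2
      rw [tau, tau, h2]
      nlinarith
  have : digit β p n ≤ digit β u n :=
    Nat.floor_le_floor (mul_le_mul_of_nonneg_left (key n le_rfl) (by linarith))
  omega

/-- Below a non-simple `p ∈ (0,1)` there are positive non-simple points whose first `m` digits
vanish. -/
theorem exists_small {β p : ℝ} (hβ : 1 < β) (h0 : 0 < p) (h1 : p < 1) (hs : ¬ IsSimple β p)
    (h2 : ∀ n, digit β p n < 2) (m : ℕ) :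
    ∃ u, 0 < u ∧ u ≤ p ∧ (0 < m → u < p) ∧ ¬ IsSimple β u ∧ (∀ n, digit β u n < 2) ∧
      ∀ i < m, digit β u i = 0 := by
  induction m with
  | zero => exact ⟨p, h0, le_rfl, by simp, hs, h2, by simp⟩
  | succ m ih =>
    obtain ⟨u, hu0, hup, -, hus, hu2, hd⟩ := ih
    obtain ⟨a, b, c⟩ := cons_coded hβ 0 hu0.le (hup.trans_lt h1) hus (fun _ => rfl)
    simp only [Fin.val_zero, Nat.cast_zero, add_zero] at a b c
    have : u / β < u := div_lt_self hu0 hβ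
    refine ⟨u / β, by positivity, by linarith, fun _ => by linarith, a, ?_, ?_⟩
    · intro n
      cases n with
      | zero => rw [c]; norm_num
      | succ n => rw [← digit_tau, b]; exact hu2 n
    intro i hi
    cases i with
    | zero => exact c
    | succ i => rw [← digit_tau, b]; exact hd i (by omega)

theorem mem_shiftSet_iff {β : ℝ} {ω : ℕ → Fin 2} :
    ω ∈ shiftSet β ↔ ∀ n, ∃ ω' ∈ coded β, ∀ m < n, ω' m = ω m := by
  constructor
  · intro h n
    have ho : IsOpen {ω' : ℕ → Fin 2 | ∀ m < n, ω' m = ω m} := by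
      have : {ω' : ℕ → Fin 2 | ∀ m < n, ω' m = ω m} =
          ⋂ m ∈ Set.Iio n, (fun ω' : ℕ → Fin 2 => ω' m) ⁻¹' {ω m} := by ext; simp
      rw [this]
      exact (Set.finite_Iio n).isOpen_biInter fun m _ =>
        (isOpen_discrete _).preimage (continuous_apply m)
    obtain ⟨ω', h1, h2⟩ := mem_closure_iff.1 h _ ho (fun _ _ => rfl)
    exact ⟨ω', h2, h1⟩
  · intro h
    choose s hs he using h
    refine mem_closure_of_tendsto (f := s) (b := atTop) ?_ (Eventually.of_forall hs)
    rw [tendsto_pi_nhds]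
    intro m
    refine tendsto_const_nhds.congr' ?_
    filter_upwards [eventually_gt_atTop m] with n hn
    exact (he n m hn).symm

/-- The set of `x` such that `jx` is admissible is an initial segment of `X_β`. -/
theorem cons_mem_of_le {β : ℝ} (hβ : 1 < β) (j : Fin 2) {x y : Shift β} (hxy : x ≤ y)
    (hy : cons j y.1 ∈ shiftSet β) : cons j x.1 ∈ shiftSet β := by
  rcases hxy.eq_or_lt with rfl | hlt
  · exact hy
  obtain ⟨k, hk, hlk⟩ := lt_def.1 hlt
  rw [mem_shiftSet_iff]
  intro N
  obtain ⟨ωx, ⟨u, hu0, -, hus, hud⟩, hux⟩ := mem_shiftSet_iff.1 x.2 (N + k + 1)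
  obtain ⟨ωy, ⟨w, hw0, hw1, hws, hwd⟩, hwy⟩ := mem_shiftSet_iff.1 hy (k + 2)
  have hp0 : 0 ≤ tau β w := tau_nonneg (by positivity)
  have hp1 := tau_lt_one β w
  have hps := not_isSimple_tau hws
  have hpd : ∀ m < k + 1, ((y.1 m : Fin 2) : ℕ) = digit β (tau β w) m := fun m hm => by
    rw [digit_tau, ← hwd, hwy (m + 1) (by omega)]; rfl
  have hxd : ∀ m < N + k + 1, ((x.1 m : Fin 2) : ℕ) = digit β u m := fun m hm => by
    rw [← hud, hux m hm]
  have hup : u < tau β w := by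
    refine lt_of_digit_lt hβ (n := k) (fun m hm => ?_) ?_
    · rw [← hxd m (by omega), ← hpd m (by omega), hk m hm]
    · rw [← hxd k (by omega), ← hpd k (by omega)]; exact hlk
  have hw : w = (tau β w + (j : ℕ)) / β := by
    have h0 : digit β w 0 = j := by rw [← hwd, hwy 0 (by omega)]; rfl
    rw [digit, Function.iterate_zero, id] at h0
    have : β ≠ 0 := by positivity
    rw [tau, h0]; field_simp; ring
  obtain ⟨v, hv0, hvp, hvs, hv2, hvd⟩ : ∃ v, 0 < v ∧ v < tau β w ∧ ¬ IsSimple β v ∧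
      (∀ n, digit β v n < 2) ∧ ∀ m < N + k + 1, ((x.1 m : Fin 2) : ℕ) = digit β v m := by
    rcases hu0.eq_or_lt with rfl | hpos
    · have hp2 : ∀ n, digit β (tau β w) n < 2 := fun n => by
        rw [digit_tau, ← hwd]; exact (ωy (n + 1)).isLt
      obtain ⟨v, h1, -, h2, h3, h5, h4⟩ := exists_small hβ hup hp1 hps hp2 (N + k + 1)
      refine ⟨v, h1, h2 (by omega), h3, h5, fun m hm => ?_⟩
      rw [hxd m hm, h4 m hm, digit]
      have : ∀ m, (tau β)^[m] 0 = 0 := fun m => by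
        induction m with
        | zero => rfl
        | succ m ih => rw [Function.iterate_succ_apply', ih, tau]; simp
      rw [this]; simp
    · exact ⟨u, hpos, hup, hus, fun n => by rw [← hud]; exact (ωx n).isLt, hxd⟩
  obtain ⟨a, b, c⟩ := cons_coded hβ j hv0.le (hvp.trans hp1) hvs (fun h => absurd h hv0.ne')
  set z := (v + (j : ℕ)) / β with hz
  have hz1 : z ≤ 1 := by
    refine le_trans ?_ hw1
    rw [hw, hz]
    gcongr
  have hz2 : ∀ n, digit β z n < 2 := by
    intro n
    cases n with
    | zero => rw [c]; exact j.isLt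
    | succ n => rw [← digit_tau, b]; exact hv2 n
  have hzd : ∀ m < N + k + 2, ((cons j x.1 m : Fin 2) : ℕ) = digit β z m := by
    intro m hm
    cases m with
    | zero => exact c.symm
    | succ m => rw [← digit_tau, b, ← hvd m (by omega)]; rfl
  refine ⟨fun n => ⟨digit β z n, hz2 n⟩, ⟨z, by positivity, hz1, a, fun _ => rfl⟩, fun m hm => ?_⟩
  exact Fin.ext (hzd m (by omega)).symm

/-- Total variation of `f : X_β → ℂ` with respect to the lexicographic order. -/
noncomputable def var {β : ℝ} (f : Shift β → ℂ) : ENNReal := eVariationOn f Set.univ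

theorem var_add_le {β : ℝ} (f g : Shift β → ℂ) : var (f + g) ≤ var f + var g := by
  refine iSup_le fun ⟨n, u, hu, hm⟩ => ?_
  calc _ ≤ ∑ i ∈ Finset.range n,
        (edist (f (u (i + 1))) (f (u i)) + edist (g (u (i + 1))) (g (u i))) :=
        Finset.sum_le_sum fun i _ => edist_add_add_le _ _ _ _
    _ ≤ _ := by
        rw [Finset.sum_add_distrib]
        exact add_le_add (eVariationOn.sum_le hu hm) (eVariationOn.sum_le hu hm)

theorem var_smul_le {β : ℝ} (c : ℂ) (f : Shift β → ℂ) : var (c • f) ≤ ‖c‖ₑ * var f := by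
  refine iSup_le fun ⟨n, u, hu, hm⟩ => ?_
  calc _ = ∑ i ∈ Finset.range n, ‖c‖ₑ * edist (f (u (i + 1))) (f (u i)) := by
        refine Finset.sum_congr rfl fun i _ => ?_
        simp only [Pi.smul_apply]
        rw [edist_smul₀]; rfl
    _ ≤ _ := by
        rw [← Finset.mul_sum]
        exact mul_le_mul_right (eVariationOn.sum_le hu hm) _

theorem var_zero {β : ℝ} : var (0 : Shift β → ℂ) = 0 :=
  eVariationOn.constant_on (by rintro _ ⟨_, -, rfl⟩ _ ⟨_, -, rfl⟩; rfl)

/-- Functions of bounded variation, as a subspace of all functions `X_β → ℂ`. -/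
def bvSubmodule (β : ℝ) : Submodule ℂ (Shift β → ℂ) where
  carrier := {f | var f < ⊤}
  zero_mem' := by simp [var_zero]
  add_mem' hf hg := (var_add_le _ _).trans_lt (ENNReal.add_lt_top.2 ⟨hf, hg⟩)
  smul_mem' c _ hf := (var_smul_le c _).trans_lt (ENNReal.mul_lt_top enorm_lt_top hf)

/-- The space `BV`. It is not reducible to a subspace of the product space, so that its topology
is the one of the norm below. -/
def BV (β : ℝ) : Type := bvSubmodule β

noncomputable instance (β : ℝ) : AddCommGroup (BV β) :=
  inferInstanceAs (AddCommGroup (bvSubmodule β))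

noncomputable instance (β : ℝ) : Module ℂ (BV β) :=
  inferInstanceAs (Module ℂ (bvSubmodule β))

/-- The function underlying an element of `BV`. -/
def BV.toFun {β : ℝ} : BV β →ₗ[ℂ] (Shift β → ℂ) := (bvSubmodule β).subtype

theorem BV.toFun_injective {β : ℝ} : Function.Injective (BV.toFun (β := β)) :=
  Subtype.val_injective

/-- The supremum norm of a function. -/
noncomputable def supNorm {β : ℝ} (f : Shift β → ℂ) : ℝ := ⨆ x, ‖f x‖

theorem BV.var_ne_top {β : ℝ} (f : BV β) : var f.toFun ≠ ⊤ := f.2.ne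

theorem BV.bddAbove {β : ℝ} (f : BV β) : BddAbove (Set.range fun x => ‖f.toFun x‖) := by
  rcases isEmpty_or_nonempty (Shift β) with h | ⟨⟨y⟩⟩
  · simp
  refine ⟨‖f.toFun y‖ + (var f.toFun).toReal, ?_⟩
  rintro _ ⟨x, rfl⟩
  have h : dist (f.toFun x) (f.toFun y) ≤ (var f.toFun).toReal := by
    rw [dist_edist]
    exact ENNReal.toReal_mono f.var_ne_top
      (eVariationOn.edist_le _ (Set.mem_univ x) (Set.mem_univ y))
  have := norm_le_norm_add_norm_sub' (f.toFun x) (f.toFun y)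
  rw [dist_eq_norm] at h
  simp only
  linarith

theorem BV.le_supNorm {β : ℝ} (f : BV β) (x : Shift β) : ‖f.toFun x‖ ≤ supNorm f.toFun :=
  le_ciSup f.bddAbove x

theorem supNorm_nonneg {β : ℝ} (f : Shift β → ℂ) : 0 ≤ supNorm f :=
  Real.iSup_nonneg fun _ => norm_nonneg _

/-- The norm `‖f‖_BV = |f|_∞ + var f`. -/
noncomputable instance (β : ℝ) : Norm (BV β) :=
  ⟨fun f => supNorm f.toFun + (var f.toFun).toReal⟩

theorem BV.norm_def {β : ℝ} (f : BV β) : ‖f‖ = supNorm f.toFun + (var f.toFun).toReal := rfl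

theorem BV.norm_smul_le' {β : ℝ} (c : ℂ) (f : BV β) : ‖c • f‖ ≤ ‖c‖ * ‖f‖ := by
  rw [BV.norm_def, BV.norm_def, mul_add, map_smul]
  refine add_le_add (Real.iSup_le (fun x => ?_) ?_) ?_
  · rw [Pi.smul_apply, norm_smul]
    exact mul_le_mul_of_nonneg_left (f.le_supNorm x) (norm_nonneg c)
  · exact mul_nonneg (norm_nonneg c) (supNorm_nonneg _)
  · have := ENNReal.toReal_mono (ENNReal.mul_ne_top enorm_ne_top f.var_ne_top)
      (var_smul_le c f.toFun)
    simpa [ENNReal.toReal_mul] using this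

noncomputable instance (β : ℝ) : NormedAddCommGroup (BV β) :=
  AddGroupNorm.toNormedAddCommGroup
    { toFun := fun f => ‖f‖
      map_zero' := by
        simp [BV.norm_def, var_zero, supNorm]
      add_le' := fun f g => by
        rw [BV.norm_def, BV.norm_def, BV.norm_def, map_add]
        have h1 : supNorm (f.toFun + g.toFun) ≤ supNorm f.toFun + supNorm g.toFun :=
          Real.iSup_le (fun x => (norm_add_le _ _).trans
            (add_le_add (f.le_supNorm x) (g.le_supNorm x)))
            (add_nonneg (supNorm_nonneg _) (supNorm_nonneg _))
        have h2 : (var (f.toFun + g.toFun)).toReal ≤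
            (var f.toFun).toReal + (var g.toFun).toReal := by
          rw [← ENNReal.toReal_add f.var_ne_top g.var_ne_top]
          exact ENNReal.toReal_mono (ENNReal.add_ne_top.2 ⟨f.var_ne_top, g.var_ne_top⟩)
            (var_add_le _ _)
        linarith
      neg' := fun f => by
        have h : ∀ g : BV β, ‖-g‖ ≤ ‖g‖ := fun g => by
          simpa using BV.norm_smul_le' (-1) g
        exact le_antisymm (h f) (by simpa using h (-f))
      eq_zero_of_map_eq_zero' := fun f h => by
        rw [BV.norm_def] at h
        have h1 := supNorm_nonneg f.toFun
        have h2 : 0 ≤ (var f.toFun).toReal := ENNReal.toReal_nonneg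
        refine BV.toFun_injective (funext fun x => ?_)
        have := f.le_supNorm x
        rw [map_zero, Pi.zero_apply, ← norm_le_zero_iff]
        linarith }

noncomputable instance (β : ℝ) : NormedSpace ℂ (BV β) where
  norm_smul_le := BV.norm_smul_le'

/-- The subspace `N` of functions in `BV` vanishing off a countable set. -/
def nullSubmodule (β : ℝ) : Submodule ℂ (BV β) where
  carrier := {f | ∃ s : Set (Shift β), s.Countable ∧ ∀ x ∉ s, f.toFun x = 0}
  zero_mem' := ⟨∅, Set.countable_empty, fun _ _ => by simp⟩
  add_mem' := by
    rintro f g ⟨s, hs, hf⟩ ⟨s', hs', hg⟩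
    refine ⟨s ∪ s', hs.union hs', fun x hx => ?_⟩
    rw [Set.mem_union, not_or] at hx
    rw [map_add, Pi.add_apply, hf x hx.1, hg x hx.2, add_zero]
  smul_mem' := by
    rintro c f ⟨s, hs, hf⟩
    exact ⟨s, hs, fun x hx => by rw [map_smul, Pi.smul_apply, hf x hx, smul_zero]⟩

/-- `N` is closed, so that `BV / N` carries the quotient norm. -/
instance isClosed_nullSubmodule (β : ℝ) : IsClosed (nullSubmodule β : Set (BV β)) := by
  refine IsSeqClosed.isClosed fun f g hf hfg => ?_
  choose s hs hz using hf
  refine ⟨⋃ n, s n, Set.countable_iUnion hs, fun x hx => ?_⟩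
  have hx' : ∀ n, (f n).toFun x = 0 := fun n => hz n x fun h => hx (Set.mem_iUnion.2 ⟨n, h⟩)
  rw [← norm_le_zero_iff]
  refine ge_of_tendsto' (tendsto_iff_norm_sub_tendsto_zero.1 hfg) fun n => ?_
  have h1 := (f n - g).le_supNorm x
  rw [map_sub, Pi.sub_apply, hx', zero_sub, norm_neg, ← map_sub] at h1
  rw [BV.norm_def]
  have h2 : 0 ≤ (var (f n - g).toFun).toReal := ENNReal.toReal_nonneg
  linarith

/-- The quotient space `BV / N`, with the quotient norm. -/
abbrev B (β : ℝ) : Type := BV β ⧸ nullSubmodule β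

/-- The subspace `U` of `B`: finite linear combinations of indicators of intervals of `X_β`,
an interval being an order-convex subset. -/
noncomputable def stepSubmodule (β : ℝ) : Submodule ℂ (B β) :=
  Submodule.span ℂ {b | ∃ (I : Set (Shift β)) (f : BV β), I.OrdConnected ∧
    f.toFun = I.indicator 1 ∧ (nullSubmodule β).mkQ f = b}

/-- The space `F`, the closure of `U` in `B`. -/
noncomputable abbrev stepClosure (β : ℝ) : Submodule ℂ (B β) := (stepSubmodule β).topologicalClosure

/-- The transfer operator of a real potential on functions:
`(L_φ f)(x) = ∑ exp(φ(y)) f(y)` over all `y` with `σ(y) = x`. -/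
noncomputable def transferFun {β : ℝ} (hβ : 1 < β) (φ : Shift β → ℝ) (f : Shift β → ℂ)
    (x : Shift β) : ℂ :=
  ∑ᶠ y : {y : Shift β // shift hβ y = x}, (Real.exp (φ y) : ℂ) * f y

/-- The potential `t χ_{C_1}`, where `C_1` is the set of sequences whose first digit is `1`. -/
noncomputable def potential {β : ℝ} (t : ℝ) : Shift β → ℝ :=
  {x : Shift β | x.1 0 = 1}.indicator fun _ => t

open Classical in
/-- The inverse branch `x ↦ jx`, as an operator on functions. -/
noncomputable def branchFun {β : ℝ} (j : Fin 2) (f : Shift β → ℂ) (x : Shift β) : ℂ :=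
  if h : cons j x.1 ∈ shiftSet β then f ⟨cons j x.1, h⟩ else 0

theorem transferFun_potential {β : ℝ} (hβ : 1 < β) (t : ℝ) (f : Shift β → ℂ) :
    transferFun hβ (potential t) f = branchFun 0 f + (Real.exp t : ℂ) • branchFun 1 f := by
  classical
  funext x
  let e : {j : Fin 2 // cons j x.1 ∈ shiftSet β} → {y : Shift β // shift hβ y = x} :=
    fun j => ⟨⟨cons j.1 x.1, j.2⟩, Shift.ext rfl⟩
  have he : Function.Bijective e := by
    constructor
    · intro j k h
      exact Subtype.ext (congrFun (congrArg (fun z => z.1.1) h) 0)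
    · rintro ⟨y, hy⟩
      have hc : cons (y.1 0) x.1 = y.1 := by
        funext n
        cases n with
        | zero => rfl
        | succ n => rw [← hy]; rfl
      exact ⟨⟨y.1 0, hc ▸ y.2⟩, Subtype.ext (Shift.ext hc)⟩
  have h1 : transferFun hβ (potential t) f x =
      ∑ᶠ j : {j : Fin 2 // cons j x.1 ∈ shiftSet β},
        (Real.exp (potential t (e j).1) : ℂ) * f (e j).1 :=
    (finsum_eq_of_bijective e he fun _ => rfl).symm
  let g : Fin 2 → ℂ := fun j => if h : cons j x.1 ∈ shiftSet β then
    (Real.exp (potential t (⟨cons j x.1, h⟩ : Shift β)) : ℂ) * f ⟨cons j x.1, h⟩ else 0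
  have h2 : transferFun hβ (potential t) f x = ∑ᶠ j : {j : Fin 2 | cons j x.1 ∈ shiftSet β}, g j :=
    h1.trans (finsum_congr fun j => by
      have hj : cons j.1 x.1 ∈ shiftSet β := j.2
      simp only [g, dif_pos hj]; rfl)
  have h3 : {j : Fin 2 | cons j x.1 ∈ shiftSet β}.indicator g = g :=
    Set.indicator_eq_self.2 fun j hj => by
      by_contra h
      exact hj (dif_neg h)
  rw [h2, finsum_set_coe_eq_finsum_mem, finsum_mem_def, h3, finsum_eq_sum_of_fintype]
  rw [Fin.sum_univ_two, Pi.add_apply, Pi.smul_apply, smul_eq_mul, branchFun, branchFun]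
  simp only [g]
  congr 1
  · split_ifs
    · simp [potential, cons]
    · rfl
  · split_ifs with h
    · have hm : (⟨cons 1 x.1, h⟩ : Shift β) ∈ {x : Shift β | x.1 0 = 1} := rfl
      have hp : potential t (⟨cons 1 x.1, h⟩ : Shift β) = t := Set.indicator_of_mem hm _
      rw [hp]
    · simp

theorem cons_mono {β : ℝ} (j : Fin 2) {x y : Shift β} (hx : cons j x.1 ∈ shiftSet β)
    (hy : cons j y.1 ∈ shiftSet β) (hxy : x ≤ y) : (⟨_, hx⟩ : Shift β) ≤ ⟨_, hy⟩ := by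
  rcases hxy.eq_or_lt with rfl | hl
  · exact le_rfl
  · obtain ⟨k, hk, hlk⟩ := lt_def.1 hl
    refine le_of_lt (lt_def.2 ⟨k + 1, fun m hm => ?_, hlk⟩)
    cases m with
    | zero => rfl
    | succ m => exact hk m (by omega)

theorem sum_branchFun_le {β : ℝ} (hβ : 1 < β) (j : Fin 2) (f : Shift β → ℂ) {u : ℕ → Shift β}
    (hu : Monotone u) (n : ℕ) (h : cons j (u n).1 ∈ shiftSet β) :
    ∑ i ∈ Finset.range n, edist (branchFun j f (u (i + 1))) (branchFun j f (u i)) ≤ var f := by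
  have hi : ∀ i, cons j (u (min i n)).1 ∈ shiftSet β := fun i =>
    cons_mem_of_le hβ j (hu (min_le_right _ _)) h
  let v : ℕ → Shift β := fun i => ⟨cons j (u (min i n)).1, hi i⟩
  have hv : Monotone v :=
    fun a b hab => cons_mono j _ _ (hu (min_le_min_right _ hab))
  have hb : ∀ i ≤ n, branchFun j f (u i) = f (v i) := by
    intro i hin
    have hm : min i n = i := min_eq_left hin
    have h' := hi i
    rw [hm] at h'
    rw [branchFun, dif_pos h']
    congr 1
    exact Shift.ext (by simp only [v, hm])
  refine le_trans (le_of_eq ?_) (eVariationOn.sum_le (f := f) (n := n) hv fun _ => Set.mem_univ _)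
  refine Finset.sum_congr rfl fun i hir => ?_
  rw [Finset.mem_range] at hir
  rw [hb i (by omega), hb (i + 1) (by omega)]

theorem norm_branchFun_le {β : ℝ} (j : Fin 2) (f : BV β) (x : Shift β) :
    ‖branchFun j f.toFun x‖ ≤ supNorm f.toFun := by
  rw [branchFun]
  split_ifs
  · exact f.le_supNorm _
  · simpa using supNorm_nonneg _

theorem var_branchFun_le {β : ℝ} (hβ : 1 < β) (j : Fin 2) (f : BV β) :
    var (branchFun j f.toFun) ≤ var f.toFun + ENNReal.ofReal (supNorm f.toFun) := by
  refine iSup_le fun ⟨n, u, hu, _⟩ => ?_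
  simp only
  induction n with
  | zero => simp
  | succ n ih =>
    by_cases h : cons j (u (n + 1)).1 ∈ shiftSet β
    · exact (sum_branchFun_le hβ j _ hu (n + 1) h).trans le_self_add
    · have h0 : branchFun j f.toFun (u (n + 1)) = 0 := by rw [branchFun, dif_neg h]
      rw [Finset.sum_range_succ]
      by_cases h' : cons j (u n).1 ∈ shiftSet β
      · refine add_le_add (sum_branchFun_le hβ j _ hu n h') ?_
        rw [h0, edist_comm, edist_zero_right, ← ofReal_norm]
        exact ENNReal.ofReal_le_ofReal (norm_branchFun_le j f _)
      · have h0' : branchFun j f.toFun (u n) = 0 := by rw [branchFun, dif_neg h']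
        rw [h0, h0', edist_self, add_zero]
        exact ih

/-- The inverse branch `x ↦ jx`, as a bounded operator on `BV`. -/
noncomputable def branch {β : ℝ} (hβ : 1 < β) (j : Fin 2) : BV β →L[ℂ] BV β :=
  LinearMap.mkContinuous
    { toFun := fun f => ⟨branchFun j f.toFun, (var_branchFun_le hβ j f).trans_lt
        (ENNReal.add_lt_top.2 ⟨f.var_ne_top.lt_top, ENNReal.ofReal_lt_top⟩)⟩
      map_add' := fun f g => BV.toFun_injective <| funext fun x => by
        change branchFun j (f + g).toFun x = branchFun j f.toFun x + branchFun j g.toFun x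
        simp only [branchFun, map_add]
        split_ifs <;> simp
      map_smul' := fun c f => BV.toFun_injective <| funext fun x => by
        change branchFun j (c • f).toFun x = c * branchFun j f.toFun x
        simp only [branchFun, map_smul]
        split_ifs <;> simp }
    2 fun f => by
      change supNorm (branchFun j f.toFun) + (var (branchFun j f.toFun)).toReal ≤ 2 * ‖f‖
      have h1 : supNorm (branchFun j f.toFun) ≤ supNorm f.toFun :=
        Real.iSup_le (norm_branchFun_le j f) (supNorm_nonneg _)
      have h2 := ENNReal.toReal_mono (ENNReal.add_ne_top.2 ⟨f.var_ne_top, ENNReal.ofReal_ne_top⟩)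
        (var_branchFun_le hβ j f)
      rw [ENNReal.toReal_add f.var_ne_top ENNReal.ofReal_ne_top,
        ENNReal.toReal_ofReal (supNorm_nonneg _)] at h2
      have h3 : 0 ≤ (var f.toFun).toReal := ENNReal.toReal_nonneg
      rw [BV.norm_def]
      linarith

theorem branch_toFun {β : ℝ} (hβ : 1 < β) (j : Fin 2) (f : BV β) :
    (branch hβ j f).toFun = branchFun j f.toFun := rfl

theorem transfer_mem {β : ℝ} (hβ : 1 < β) (t : ℝ) (f : BV β) :
    var (transferFun hβ (potential t) f.toFun) < ⊤ := by
  rw [transferFun_potential]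
  exact (branch hβ 0 f + (Real.exp t : ℂ) • branch hβ 1 f).2

/-- The transfer operator `L_t = L_{t χ_{C_1}}` on `BV`. -/
noncomputable def transferBV {β : ℝ} (hβ : 1 < β) (t : ℝ) : BV β →L[ℂ] BV β :=
  (branch hβ 0 + (Real.exp t : ℂ) • branch hβ 1).copy
    (fun f => ⟨transferFun hβ (potential t) f.toFun, transfer_mem hβ t f⟩)
    (funext fun f => BV.toFun_injective (transferFun_potential hβ t f.toFun))

theorem transferBV_eq {β : ℝ} (hβ : 1 < β) (t : ℝ) :
    transferBV hβ t = branch hβ 0 + (Real.exp t : ℂ) • branch hβ 1 :=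
  ContinuousLinearMap.copy_eq _ _ _

theorem branch_mem_null {β : ℝ} (hβ : 1 < β) (j : Fin 2) {f : BV β}
    (hf : f ∈ nullSubmodule β) : branch hβ j f ∈ nullSubmodule β := by
  obtain ⟨s, hs, hz⟩ := hf
  refine ⟨(shift hβ) '' s, hs.image _, fun x hx => ?_⟩
  rw [branch_toFun, branchFun]
  split_ifs with h
  · exact hz _ fun hmem => hx ⟨_, hmem, rfl⟩
  · rfl

theorem transferBV_mem_null {β : ℝ} (hβ : 1 < β) (t : ℝ) {f : BV β}
    (hf : f ∈ nullSubmodule β) : transferBV hβ t f ∈ nullSubmodule β := by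
  rw [transferBV_eq]
  exact add_mem (branch_mem_null hβ 0 hf) (Submodule.smul_mem _ _ (branch_mem_null hβ 1 hf))

/-- The transfer operator `L_t` on the quotient space `BV / N`. -/
noncomputable def transferB {β : ℝ} (hβ : 1 < β) (t : ℝ) : B β →L[ℂ] B β :=
  (nullSubmodule β).liftQL ((nullSubmodule β).mkQL.comp (transferBV hβ t)) fun f hf => by
    rw [LinearMap.mem_ker]
    exact (Submodule.Quotient.mk_eq_zero _).2 (transferBV_mem_null hβ t hf)

theorem transferB_mk {β : ℝ} (hβ : 1 < β) (t : ℝ) (f : BV β) :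
    transferB hβ t ((nullSubmodule β).mkQ f) = (nullSubmodule β).mkQ (transferBV hβ t f) := rfl

theorem branch_step {β : ℝ} (hβ : 1 < β) (j : Fin 2) {I : Set (Shift β)} {f : BV β}
    (hI : I.OrdConnected) (hf : f.toFun = I.indicator 1) :
    (nullSubmodule β).mkQ (branch hβ j f) ∈ stepSubmodule β := by
  classical
  refine Submodule.subset_span ⟨{x : Shift β | ∃ h : cons j x.1 ∈ shiftSet β, (⟨_, h⟩ : Shift β) ∈ I},
    branch hβ j f, ⟨?_⟩, ?_, rfl⟩
  · rintro x ⟨hx, hxI⟩ y ⟨hy, hyI⟩ z ⟨hxz, hzy⟩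
    have hz := cons_mem_of_le hβ j hzy hy
    exact ⟨hz, hI.out hxI hyI ⟨cons_mono j hx hz hxz, cons_mono j hz hy hzy⟩⟩
  · funext x
    rw [branch_toFun, branchFun, hf]
    by_cases h : cons j x.1 ∈ shiftSet β
    · rw [dif_pos h]
      by_cases hI' : (⟨_, h⟩ : Shift β) ∈ I
      · have hx : x ∈ {x : Shift β | ∃ h : cons j x.1 ∈ shiftSet β, (⟨_, h⟩ : Shift β) ∈ I} :=
          ⟨h, hI'⟩
        rw [Set.indicator_of_mem hI', Set.indicator_of_mem hx]; rfl
      · rw [Set.indicator_of_notMem hI', Set.indicator_of_notMem fun h' => hI' h'.2]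
    · rw [dif_neg h, Set.indicator_of_notMem fun h' => h h'.1]

theorem transferB_mem {β : ℝ} (hβ : 1 < β) (t : ℝ) {b : B β} (hb : b ∈ stepClosure β) :
    transferB hβ t b ∈ stepClosure β := by
  have h : stepSubmodule β ≤ (stepSubmodule β).comap (transferB hβ t).toLinearMap := by
    refine Submodule.span_le.2 ?_
    rintro _ ⟨I, f, hI, hf, rfl⟩
    change transferB hβ t _ ∈ stepSubmodule β
    rw [transferB_mk, transferBV_eq]
    exact add_mem (branch_step hβ 0 hI hf) (Submodule.smul_mem _ _ (branch_step hβ 1 hI hf))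
  have hm : Set.MapsTo (transferB hβ t) (stepSubmodule β) (stepSubmodule β) := h
  exact hm.closure (transferB hβ t).continuous hb

/-- The transfer operator `L_t` on `F`. -/
noncomputable def transfer {β : ℝ} (hβ : 1 < β) (t : ℝ) : stepClosure β →L[ℂ] stepClosure β :=
  ((transferB hβ t).comp (stepClosure β).subtypeL).codRestrict (stepClosure β)
    fun b => transferB_mem hβ t b.2

/-- `λ` is an isolated eigenvalue of the bounded operator `T`: an eigenvalue that is an isolated
point of the spectrum. -/
def IsIsolatedEigenvalue {E : Type*} [NormedAddCommGroup E] [NormedSpace ℂ E] (T : E →L[ℂ] E)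
    (l : ℂ) : Prop :=
  (∃ v : E, v ≠ 0 ∧ T v = l • v) ∧ ∀ᶠ z in 𝓝[≠] l, z ∉ spectrum ℂ T

/-- The Birkhoff sum `S_n φ = ∑_{i < n} φ ∘ σ^i`. -/
noncomputable def birkhoff {β : ℝ} (hβ : 1 < β) (φ : Shift β → ℝ) (n : ℕ) (x : Shift β) : ℝ :=
  ∑ i ∈ Finset.range n, φ ((shift hβ)^[i] x)

/-- `r_t`, the limit superior of `(exp (sup S_n φ))^{1/n}` for `φ = t χ_{C_1}`. -/
noncomputable def rt {β : ℝ} (hβ : 1 < β) (t : ℝ) : ℝ :=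
  limsup (fun n : ℕ => Real.exp (⨆ x, birkhoff hβ (potential t) n x) ^ (1 / (n : ℝ))) atTop

/-- The `n`-th term (`n ≥ 0`) of `φ_t(z)`, namely `q_{n+1}(1) H_n(t, q(1)) z^{n+1}` with
`H_n(t, q(1)) = exp (t ∑_{i ≤ n} q_i(1))`. -/
noncomputable def phiTerm (β t : ℝ) (z : ℂ) (n : ℕ) : ℂ :=
  (quasiGreedyOne β n : ℂ) *
    (Real.exp ((∑ i ∈ Finset.range n, (quasiGreedyOne β i : ℝ)) * t) : ℂ) * z ^ (n + 1)

/-- The power series `φ_t(z)`. -/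
noncomputable def phi (β t : ℝ) (z : ℂ) : ℂ := ∑' n, phiTerm β t z n

end BetaTransfer

/-!
Let `Y` be the set of points of the beta-shift with infinitely many digits `1`, and `q ∈ Y` the
quasi-greedy expansion of `1`, which is the largest point of the shift (`le_quasiGreedySeq`).

The indicator functions of the sets `Iic w`, `w ∈ Y`, are a basis of `F` in the sense of `ℓ¹`: the
map `a ↦ ∑ a_w 1_{Iic w}` is an isomorphism from `ℓ¹(Y)` onto `F` (`jumpEquiv`). It is bounded below
because every interval `(v, w)` with `v < w`, `w ∈ Y`, is uncountable (`not_countable_Ioo`), so that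
modifying a function on a countable set cannot hide a jump (`norm_le_norm_jumpSumB`). It is onto
because every lower set agrees, up to a countable set, with the empty set or with some `Iic w`,
`w ∈ Y` (`isLowerSet_ae_eq`).

On this basis `L_t 1_{Iic w} = w₁ 1_{Iic q} + exp(t w₁) 1_{Iic σw}` (`jumpTransfer_unitJump`). So
`L_t` is the sum of the weighted shift `A : e_w ↦ exp(t w₁) e_{σw}` and the rank-one operator
`ℓ ⊗ e_q`, where `ℓ` reads off the first digit. Since `‖Aⁿ‖` is at most the supremum of
`exp (S_n (t χ))`, where `S_n` denotes the `n`-th Birkhoff sum and `χ` the indicator function of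
`C₁`, the Neumann series of `(1 - zA)⁻¹` converges for `|z| < 1 / r_t`. The operator
`1 - z (A + ℓ ⊗ e_q)` is then invertible unless `z ℓ((1 - zA)⁻¹ e_q) = 1`, and in that case
`(1 - zA)⁻¹ e_q` is an eigenvector. The left side is `∑ zⁿ⁺¹ ℓ(Aⁿ e_q) = φ_t(z)` (`phiTerm_eq`).
Finally `1 - φ_t` is holomorphic on a disc about `0` and equals `1` at `0`, so its zeros are
isolated, and with them the eigenvalues (`isIsolatedEigenvalue_iff_rankOneSeries`).
-/

namespace BetaTransfer

open Filter Topology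

/-! ### Rank-one perturbations -/

section Perturbation

variable {E : Type*} [NormedAddCommGroup E] [NormedSpace ℂ E]

theorem summable_smul_pow [CompleteSpace E] {A : E →L[ℂ] E} {C ρ : ℝ} (hρ : 0 < ρ)
    (hA : ∀ n, ‖A ^ n‖ ≤ C * ρ ^ n) {z : ℂ} (hz : ‖z‖ * ρ < 1) :
    Summable fun n : ℕ => (z • A) ^ n := by
  refine Summable.of_norm_bounded (g := fun n => C * (‖z‖ * ρ) ^ n)
    ((summable_geometric_of_lt_one (by positivity) hz).mul_left C) fun n => ?_
  rw [smul_pow, norm_smul, norm_pow, mul_pow]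
  calc ‖z‖ ^ n * ‖A ^ n‖ ≤ ‖z‖ ^ n * (C * ρ ^ n) := by gcongr; exact hA n
    _ = _ := by ring

/-- The function `z ↦ ∑ ℓ(Aⁿ e) zⁿ⁺¹`; the operator `1 - z (A + ℓ ⊗ e)` is singular exactly where
it takes the value `1`. -/
noncomputable def rankOneSeries (A : E →L[ℂ] E) (ℓ : E →L[ℂ] ℂ) (e : E) (z : ℂ) : ℂ :=
  ∑' n : ℕ, ℓ ((A ^ n) e) * z ^ (n + 1)

theorem rankOneSeries_eq {A : E →L[ℂ] E} (ℓ : E →L[ℂ] ℂ) (e : E) {z : ℂ}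
    (hs : Summable fun n : ℕ => (z • A) ^ n) :
    rankOneSeries A ℓ e z = z * ℓ ((∑' n : ℕ, (z • A) ^ n) e) := by
  have h1 : HasSum (fun n : ℕ => ℓ (((z • A) ^ n) e)) (ℓ ((∑' n : ℕ, (z • A) ^ n) e)) :=
    ((hs.hasSum.mapL (ContinuousLinearMap.apply ℂ E e)).mapL ℓ)
  rw [rankOneSeries, ← h1.tsum_eq, ← tsum_mul_left]
  refine tsum_congr fun n => ?_
  rw [smul_pow, smul_apply, map_smul, smul_eq_mul]
  ring

/-- An eigenvector `v` is a multiple of `(1 - l⁻¹A)⁻¹ e`, and applying `ℓ` to this relation gives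
the condition on `l`. -/
theorem eigenvector_iff_rankOneSeries {A : E →L[ℂ] E} (ℓ : E →L[ℂ] ℂ) {e : E} (he : e ≠ 0) {l : ℂ}
    (hl : l ≠ 0) (hs : Summable fun n : ℕ => (l⁻¹ • A) ^ n) :
    (∃ v : E, v ≠ 0 ∧ (A + ℓ.smulRight e) v = l • v) ↔ rankOneSeries A ℓ e l⁻¹ = 1 := by
  rw [rankOneSeries_eq ℓ e hs]
  have hr := hs.one_sub_mul_tsum_pow
  have hll := hs.tsum_pow_mul_one_sub
  set N := ∑' n : ℕ, (l⁻¹ • A) ^ n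
  have hr' : ∀ v, N v - l⁻¹ • A (N v) = v := fun v => by simpa using congrArg (fun B => B v) hr
  have hl' : ∀ v, N (v - l⁻¹ • A v) = v := fun v => by simpa using congrArg (fun B => B v) hll
  constructor
  · rintro ⟨v, hv, h⟩
    have h1 : v - l⁻¹ • A v = (l⁻¹ * ℓ v) • e := by
      have h2 : v = l⁻¹ • (A v + ℓ v • e) := by
        rw [eq_inv_smul_iff₀ hl, ← h]; simp
      nth_rewrite 1 [h2]
      rw [smul_add, add_sub_cancel_left, smul_smul]
    have h3 : v = (l⁻¹ * ℓ v) • N e := by rw [← map_smul, ← h1, hl']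
    have h4 : ℓ v ≠ 0 := fun h0 => hv (by rw [h3, h0]; simp)
    have h5 := congrArg ℓ h3
    rw [map_smul, smul_eq_mul] at h5
    refine mul_right_cancel₀ h4 ?_
    rw [one_mul]
    nth_rewrite 2 [h5]
    ring
  · intro h
    refine ⟨N e, fun h0 => he ?_, ?_⟩
    · rw [← hr' e, h0]; simp
    · have h1 : ℓ (N e) = l := by
        rw [inv_mul_eq_one₀ hl] at h
        exact h.symm
      have h2 := congrArg (fun v => l • v) (hr' e)
      simp only [smul_sub, smul_inv_smul₀ hl] at h2
      rw [add_apply, ContinuousLinearMap.smulRight_apply, h1, ← h2]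
      abel

theorem notMem_spectrum_of_rankOneSeries {A : E →L[ℂ] E} (ℓ : E →L[ℂ] ℂ) (e : E) {l : ℂ}
    (hl : l ≠ 0) (hs : Summable fun n : ℕ => (l⁻¹ • A) ^ n) (h : rankOneSeries A ℓ e l⁻¹ ≠ 1) :
    l ∉ spectrum ℂ (A + ℓ.smulRight e) := by
  rw [rankOneSeries_eq ℓ e hs] at h
  have hr := hs.one_sub_mul_tsum_pow
  have hll := hs.tsum_pow_mul_one_sub
  set N := ∑' n : ℕ, (l⁻¹ • A) ^ n
  have hr' : ∀ v, A (N v) = l • (N v - v) := fun v => by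
    have : N v - l⁻¹ • A (N v) = v := by simpa using congrArg (fun B => B v) hr
    rw [← inv_smul_eq_iff₀ hl]; nth_rewrite 3 [← this]; abel
  have hl' : ∀ v, N (A v) = l • (N v - v) := fun v => by
    have : N v - l⁻¹ • N (A v) = v := by simpa using congrArg (fun B => B v) hll
    rw [← inv_smul_eq_iff₀ hl]; nth_rewrite 3 [← this]; abel
  set s : ℂ := l⁻¹ * ℓ (N e) with hsdef
  have hs1 : 1 - s ≠ 0 := fun h0 => h (by linear_combination -h0)
  have hls : ℓ (N e) = l * s := by rw [hsdef]; field_simp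
  -- the Sherman–Morrison formula for the inverse of `l - A - ℓ ⊗ e`
  let R : E →L[ℂ] E := l⁻¹ • (N + (l * (1 - s))⁻¹ • (ℓ.comp N).smulRight (N e))
  rw [spectrum.notMem_iff]
  refine ⟨⟨algebraMap ℂ (E →L[ℂ] E) l - (A + ℓ.smulRight e), R, ?_, ?_⟩, rfl⟩
  · ext v
    simp only [R, mul_apply_eq_comp, sub_apply,
      add_apply, smul_apply,
      ContinuousLinearMap.smulRight_apply, ContinuousLinearMap.comp_apply, map_add, map_smul, hr',
      hls, Algebra.algebraMap_eq_smul_one, one_apply_eq_self]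
    match_scalars <;> field_simp <;> ring
  · ext v
    simp only [R, mul_apply_eq_comp, sub_apply,
      add_apply, smul_apply,
      ContinuousLinearMap.smulRight_apply, ContinuousLinearMap.comp_apply, map_add, map_smul,
      map_sub, hl', hls, Algebra.algebraMap_eq_smul_one, one_apply_eq_self, smul_eq_mul]
    match_scalars <;> field_simp <;> ring

/-- Zeros of `1 - rankOneSeries` are isolated: this function is holomorphic on a disc about `0`
and takes the value `1` at `0`. -/
theorem eventually_rankOneSeries_ne_one {A : E →L[ℂ] E} {C ρ : ℝ} (hρ : 0 < ρ)
    (hA : ∀ n, ‖A ^ n‖ ≤ C * ρ ^ n) (ℓ : E →L[ℂ] ℂ) (e : E) {z : ℂ} (hz : ‖z‖ * ρ < 1) :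
    ∀ᶠ w in 𝓝[≠] z, rankOneSeries A ℓ e w ≠ 1 := by
  obtain ⟨r, hzr, hr1⟩ := exists_between ((lt_div_iff₀ hρ).2 hz)
  have hr0 : 0 < r := (norm_nonneg z).trans_lt hzr
  have hrρ : r * ρ < 1 := (lt_div_iff₀ hρ).1 hr1
  have hC : 0 ≤ C := by simpa using (norm_nonneg _).trans (hA 0)
  have hd : DifferentiableOn ℂ (rankOneSeries A ℓ e) (Metric.ball 0 r) := by
    refine Complex.differentiableOn_tsum_of_summable_norm
      (u := fun n : ℕ => (‖ℓ‖ * (C * ‖e‖) * r) * (r * ρ) ^ n)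
      ((summable_geometric_of_lt_one (by positivity) hrρ).mul_left _) (fun n => by fun_prop)
      Metric.isOpen_ball fun n w hw => ?_
    rw [mem_ball_zero_iff] at hw
    rw [norm_mul, norm_pow]
    calc ‖ℓ ((A ^ n) e)‖ * ‖w‖ ^ (n + 1) ≤ (‖ℓ‖ * (C * ρ ^ n * ‖e‖)) * r ^ (n + 1) := by
          gcongr
          refine (ℓ.le_opNorm _).trans ?_
          gcongr
          refine ((A ^ n).le_opNorm _).trans ?_
          gcongr
          exact hA n
      _ = _ := by ring
  have ha := (hd.sub_const 1).analyticOnNhd Metric.isOpen_ball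
  have hm : z ∈ Metric.ball (0 : ℂ) r := by simpa using hzr
  by_contra hf
  have h0 := ha.eqOn_zero_of_preconnected_of_frequently_eq_zero
    (convex_ball (0 : ℂ) r).isPreconnected hm
    ((Filter.not_eventually.1 hf).mono fun w hw => sub_eq_zero.2 (not_not.1 hw))
    (Metric.mem_ball_self hr0)
  simp [rankOneSeries] at h0

theorem isIsolatedEigenvalue_iff_rankOneSeries [CompleteSpace E] {A : E →L[ℂ] E} {C ρ : ℝ}
    (hρ : 0 < ρ) (hA : ∀ n, ‖A ^ n‖ ≤ C * ρ ^ n) (ℓ : E →L[ℂ] ℂ) {e : E} (he : e ≠ 0) {l : ℂ}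
    (hl : ρ < ‖l‖) :
    IsIsolatedEigenvalue (A + ℓ.smulRight e) l ↔ rankOneSeries A ℓ e l⁻¹ = 1 := by
  have hl0 : ∀ {m : ℂ}, ρ < ‖m‖ → m ≠ 0 := fun h => norm_pos_iff.1 (hρ.trans h)
  have hz : ∀ {m : ℂ}, ρ < ‖m‖ → ‖m⁻¹‖ * ρ < 1 := fun h => by
    rw [norm_inv, inv_mul_lt_one₀ (hρ.trans h)]; exact h
  have hs := fun {m : ℂ} (h : ρ < ‖m‖) => summable_smul_pow hρ hA (hz h)
  rw [IsIsolatedEigenvalue, eigenvector_iff_rankOneSeries ℓ he (hl0 hl) (hs hl),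
    and_iff_left_iff_imp]
  intro _
  have hi : Tendsto (fun m : ℂ => m⁻¹) (𝓝[≠] l) (𝓝[≠] l⁻¹) :=
    tendsto_nhdsWithin_of_tendsto_nhds_of_eventually_within _
      ((continuousAt_inv₀ (hl0 hl)).tendsto.mono_left nhdsWithin_le_nhds) <| by
        filter_upwards [self_mem_nhdsWithin] with m hm using fun h => hm (inv_injective h)
  have hnorm : ∀ᶠ m : ℂ in 𝓝[≠] l, ρ < ‖m‖ :=
    nhdsWithin_le_nhds (continuous_norm.continuousAt.eventually (lt_mem_nhds hl))
  filter_upwards [hi.eventually (eventually_rankOneSeries_ne_one hρ hA ℓ e (hz hl)), hnorm]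
    with m hm hm'
  exact notMem_spectrum_of_rankOneSeries ℓ e (hl0 hm') (hs hm') hm

end Perturbation

/-! ### Simple points and the quasi-greedy map -/

theorem countable_preimage_tau {β : ℝ} (hβ : 1 < β) {s : Set ℝ} (hs : s.Countable) :
    (tau β ⁻¹' s).Countable := by
  refine (Set.countable_iUnion fun k : ℕ => hs.image fun y => (y + k) / β).mono fun x hx => ?_
  refine Set.mem_iUnion.2 ⟨⌊β * x⌋₊, tau β x, hx, ?_⟩
  have : β ≠ 0 := by positivity
  simp only [tau]
  field_simp
  ring

theorem countable_setOf_isSimple {β : ℝ} (hβ : 1 < β) : {x | IsSimple β x}.Countable := by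
  have h : ∀ (n : ℕ) (s : Set ℝ), s.Countable → ((tau β)^[n] ⁻¹' s).Countable := by
    intro n
    induction n with
    | zero => exact fun s hs => hs
    | succ n ih =>
      intro s hs
      rw [Function.iterate_succ', Set.preimage_comp]
      exact ih _ (countable_preimage_tau hβ hs)
  refine (Set.countable_iUnion fun n : ℕ => Set.countable_iUnion fun k : ℕ =>
    h n {(k : ℝ) / β} (Set.countable_singleton _)).mono ?_
  rintro x ⟨n, k, -, e⟩
  have : β ≠ 0 := by positivity
  refine Set.mem_iUnion.2 ⟨n, Set.mem_iUnion.2 ⟨k, ?_⟩⟩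
  rw [Set.mem_preimage, Set.mem_singleton_iff, ← e]
  field_simp

theorem iterate_tau_mem {β x : ℝ} (hβ : 1 < β) (h0 : 0 ≤ x) (h1 : x < 1) (n : ℕ) :
    0 ≤ (tau β)^[n] x ∧ (tau β)^[n] x < 1 := by
  induction n with
  | zero => exact ⟨h0, h1⟩
  | succ n ih =>
    rw [Function.iterate_succ_apply']
    exact ⟨tau_nonneg (mul_nonneg (by linarith) ih.1), tau_lt_one _ _⟩

theorem digit_lt_two {β x : ℝ} (hβ : 1 < β) (hβ' : β ≤ 2) (h0 : 0 ≤ x) (h1 : x < 1) (n : ℕ) :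
    digit β x n < 2 := by
  obtain ⟨a, b⟩ := iterate_tau_mem hβ h0 h1 n
  rw [digit, Nat.floor_lt (mul_nonneg (by linarith) a)]
  push_cast
  nlinarith

/-- Two points with the same digits have orbits whose distance grows by the factor `β` at each
step, so they agree. -/
theorem eq_of_digit_eq {β u p : ℝ} (hβ : 1 < β) (hu0 : 0 ≤ u) (hu1 : u < 1) (hp0 : 0 ≤ p)
    (hp1 : p < 1) (h : ∀ n, digit β u n = digit β p n) : u = p := by
  have key : ∀ n, (tau β)^[n] u - (tau β)^[n] p = β ^ n * (u - p) := by
    intro n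
    induction n with
    | zero => simp
    | succ n ih =>
      have h2 := h n
      rw [digit, digit] at h2
      rw [Function.iterate_succ_apply', Function.iterate_succ_apply', tau, tau, h2, pow_succ]
      linear_combination β * ih
  by_contra hne
  obtain ⟨n, hn⟩ := pow_unbounded_of_one_lt (1 / |u - p|) hβ
  rw [div_lt_iff₀ (abs_pos.2 (sub_ne_zero.2 hne))] at hn
  have h1 := iterate_tau_mem hβ hu0 hu1 n
  have h2 := iterate_tau_mem hβ hp0 hp1 n
  have h3 : |(tau β)^[n] u - (tau β)^[n] p| < 1 := abs_sub_lt_iff.2 ⟨by linarith, by linarith⟩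
  rw [key, abs_mul, abs_of_pos (by positivity)] at h3
  linarith

/-- The left-continuous version `x ↦ βx - (⌈βx⌉ - 1)` of the beta-map, which maps `(0,1]` to
itself. -/
noncomputable def leftTau (β x : ℝ) : ℝ := β * x - ((⌈β * x⌉₊ : ℝ) - 1)

/-- The digits produced by `leftTau`. The natural subtraction does not truncate for `x > 0`. -/
noncomputable def leftDigit (β x : ℝ) (n : ℕ) : ℕ := ⌈β * (leftTau β)^[n] x⌉₊ - 1

theorem leftTau_mem {β x : ℝ} (hβ : 1 < β) (h0 : 0 < x) : 0 < leftTau β x ∧ leftTau β x ≤ 1 := by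
  have h1 := Nat.ceil_lt_add_one (a := β * x) (by positivity)
  have h2 := Nat.le_ceil (β * x)
  unfold leftTau
  exact ⟨by linarith, by linarith⟩

theorem iterate_leftTau_pos {β x : ℝ} (hβ : 1 < β) (h0 : 0 < x) (n : ℕ) :
    0 < (leftTau β)^[n] x := by
  induction n with
  | zero => exact h0
  | succ n ih => rw [Function.iterate_succ_apply']; exact (leftTau_mem hβ ih).1

theorem eventually_floor_eq {β x : ℝ} (hβ : 1 < β) (h0 : 0 < x) :
    ∀ᶠ y in 𝓝[<] x, ⌊β * y⌋₊ = ⌈β * x⌉₊ - 1 := by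
  have hpos : 0 < β * x := by positivity
  have h1 := Nat.ceil_lt_add_one hpos.le
  have hc : 1 ≤ ⌈β * x⌉₊ := Nat.ceil_pos.2 hpos
  have hev : ∀ᶠ y in 𝓝[<] x, (⌈β * x⌉₊ : ℝ) - 1 < β * y :=
    nhdsWithin_le_nhds ((by fun_prop : Continuous fun y : ℝ => β * y).continuousAt.eventually
      (lt_mem_nhds (by linarith)))
  filter_upwards [hev, self_mem_nhdsWithin] with y hy hyx
  have hyx' : β * y < β * x := mul_lt_mul_of_pos_left hyx (by linarith)
  have hcast : ((⌈β * x⌉₊ - 1 : ℕ) : ℝ) = (⌈β * x⌉₊ : ℝ) - 1 := by push_cast [hc]; ring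
  rw [Nat.floor_eq_iff, hcast]
  · exact ⟨hy.le, by linarith [Nat.le_ceil (β * x)]⟩
  · have : (1 : ℝ) ≤ ⌈β * x⌉₊ := by exact_mod_cast hc
    linarith

theorem eventually_digit_eq_leftDigit {β : ℝ} (hβ : 1 < β) (n : ℕ) :
    ∀ {x : ℝ}, 0 < x → ∀ᶠ y in 𝓝[<] x, digit β y n = leftDigit β x n := by
  induction n with
  | zero => exact fun h0 => eventually_floor_eq hβ h0
  | succ n ih =>
    intro x h0
    have hc : 1 ≤ ⌈β * x⌉₊ := Nat.ceil_pos.2 (by positivity)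
    have hev : ∀ᶠ y in 𝓝[<] x, tau β y = β * y - ((⌈β * x⌉₊ : ℝ) - 1) := by
      filter_upwards [eventually_floor_eq hβ h0] with y hy
      rw [tau, hy]; push_cast [hc]; ring
    have ht : Tendsto (tau β) (𝓝[<] x) (𝓝[<] (leftTau β x)) := by
      refine tendsto_nhdsWithin_of_tendsto_nhds_of_eventually_within _ ?_ ?_
      · refine Tendsto.congr' (hev.mono fun y hy => hy.symm) ?_
        exact Tendsto.mono_left (by fun_prop : Continuous fun y : ℝ =>
          β * y - ((⌈β * x⌉₊ : ℝ) - 1)).continuousAt.tendsto nhdsWithin_le_nhds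
      · filter_upwards [hev, self_mem_nhdsWithin] with y hy hyx
        rw [hy, Set.mem_Iio, leftTau]
        have : β * y < β * x := mul_lt_mul_of_pos_left hyx (by linarith)
        linarith
    filter_upwards [ht.eventually (ih (leftTau_mem hβ h0).1)] with y hy
    rw [← digit_tau, hy, leftDigit, leftDigit, Function.iterate_succ_apply]

theorem ceil_eq_floor_add_one {y : ℝ} (h0 : 0 < y) (h : ∀ k : ℕ, 1 ≤ k → y ≠ k) :
    ⌈y⌉₊ = ⌊y⌋₊ + 1 := by
  rw [Nat.ceil_eq_iff (by omega)]
  have h1 := Nat.floor_le h0.le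
  have h2 := Nat.lt_floor_add_one y
  refine ⟨?_, by push_cast; exact h2.le⟩
  rw [Nat.add_sub_cancel]
  rcases Nat.eq_zero_or_pos ⌊y⌋₊ with h3 | h3
  · rw [h3]; simpa using h0
  · exact lt_of_le_of_ne h1 (h _ h3).symm

theorem iterate_leftTau_eq {β x : ℝ} (hβ : 1 < β) (h0 : 0 < x) {m : ℕ}
    (h : ∀ i < m, ∀ k : ℕ, 1 ≤ k → β * (tau β)^[i] x ≠ k) : (leftTau β)^[m] x = (tau β)^[m] x := by
  induction m with
  | zero => rfl
  | succ m ih =>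
    have hm := ih fun i hi => h i (by omega)
    have hp := iterate_leftTau_pos hβ h0 m
    rw [Function.iterate_succ_apply', Function.iterate_succ_apply', hm]
    rw [hm] at hp
    rw [leftTau, tau, ceil_eq_floor_add_one (by positivity) (h m (by omega))]
    push_cast; ring

theorem leftDigit_eq_digit {β x : ℝ} (hβ : 1 < β) (h0 : 0 < x) {m : ℕ}
    (h : ∀ i ≤ m, ∀ k : ℕ, 1 ≤ k → β * (tau β)^[i] x ≠ k) : leftDigit β x m = digit β x m := by
  have hm := iterate_leftTau_eq hβ h0 fun i (hi : i < m) => h i hi.le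
  have hp := iterate_leftTau_pos hβ h0 m
  rw [hm] at hp
  rw [leftDigit, digit, hm, ceil_eq_floor_add_one (by positivity) (h m le_rfl),
    Nat.add_sub_cancel]

/-- The quasi-greedy expansion of `1` is its expansion under the left-continuous beta-map. -/
theorem leftDigit_one {β : ℝ} (hβ : 1 < β) (n : ℕ) : leftDigit β 1 n = quasiGreedyOne β n := by
  classical
  by_cases hS : IsSimple β 1
  · have hmin : ∀ i < Nat.find hS, ∀ k : ℕ, 1 ≤ k → β * (tau β)^[i] 1 ≠ k :=
      fun i hi k hk e => Nat.find_min hS hi ⟨k, hk, e⟩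
    obtain ⟨k, hk, e⟩ := Nat.find_spec hS
    have hs := iterate_leftTau_eq hβ one_pos hmin
    have hper : Function.IsPeriodicPt (leftTau β) (Nat.find hS + 1) 1 := by
      rw [Function.IsPeriodicPt, Function.IsFixedPt, Function.iterate_succ_apply', hs, leftTau, e,
        Nat.ceil_natCast]
      ring
    rw [leftDigit, ← hper.iterate_mod_apply n, ← leftDigit]
    have hlt : n % (Nat.find hS + 1) < Nat.find hS + 1 := Nat.mod_lt _ (by omega)
    rw [quasiGreedyOne, dif_pos hS]
    split_ifs with hn
    · have hn' : n % (Nat.find hS + 1) = Nat.find hS := by convert hn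
      rw [hn', leftDigit, digit, hs]
      erw [e]
      rw [Nat.ceil_natCast, Nat.floor_natCast]
    · have hn' : n % (Nat.find hS + 1) ≠ Nat.find hS := fun h => hn (by convert h)
      exact leftDigit_eq_digit hβ one_pos fun i hi => hmin i (by omega)
  · rw [quasiGreedyOne, dif_neg hS]
    exact leftDigit_eq_digit hβ one_pos fun i _ k hk e => hS ⟨i, k, hk, e⟩

/-- Points just below `1` whose greedy digits start like the quasi-greedy expansion of `1`. -/
theorem exists_digit_eq_quasiGreedyOne {β : ℝ} (hβ : 1 < β) {a : ℝ} (ha : a < 1) (N : ℕ) :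
    ∃ y, 0 < y ∧ a < y ∧ y < 1 ∧ ¬ IsSimple β y ∧ ∀ n < N, digit β y n = quasiGreedyOne β n := by
  have h1 : ∀ᶠ y in 𝓝[<] (1 : ℝ), ∀ n < N, digit β y n = quasiGreedyOne β n := by
    have : ∀ᶠ y in 𝓝[<] (1 : ℝ), ∀ n ∈ Set.Iio N, digit β y n = quasiGreedyOne β n := by
      rw [Filter.eventually_all_finite (Set.finite_Iio N)]
      intro n _
      rw [← leftDigit_one hβ]
      exact eventually_digit_eq_leftDigit hβ n one_pos
    exact this
  obtain ⟨b, hb, hb'⟩ := (mem_nhdsLT_iff_exists_Ioo_subset).1 h1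
  obtain ⟨y, hy, hy'⟩ := ((countable_setOf_isSimple hβ).dense_compl ℝ).exists_mem_open
    (isOpen_Ioo (a := max (max a b) 0) (b := 1)) (Set.nonempty_Ioo.2 (by simp_all))
  obtain ⟨h2, h3⟩ := hy'
  simp only [max_lt_iff] at h2
  exact ⟨y, h2.2, h2.1.1, h3, hy, hb' ⟨h2.1.2, h3⟩⟩

/-- If all digits vanished from some point on, the orbit in `(0,1]` would grow like `βⁿ`. -/
theorem exists_quasiGreedyOne_ne_zero {β : ℝ} (hβ : 1 < β) (N : ℕ) :
    ∃ n, N ≤ n ∧ quasiGreedyOne β n ≠ 0 := by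
  by_contra! h
  have hp := iterate_leftTau_pos hβ one_pos N
  have key : ∀ m, (leftTau β)^[N + m] 1 = β ^ m * (leftTau β)^[N] 1 := by
    intro m
    induction m with
    | zero => simp
    | succ m ih =>
      have h1 := h (N + m) (by omega)
      rw [← leftDigit_one hβ, leftDigit] at h1
      have h2 : 0 < ⌈β * (leftTau β)^[N + m] 1⌉₊ := by
        have := iterate_leftTau_pos hβ one_pos (N + m)
        exact Nat.ceil_pos.2 (by positivity)
      have h3 : ⌈β * (leftTau β)^[N + m] 1⌉₊ = 1 := by omega
      rw [← add_assoc, Function.iterate_succ_apply', leftTau, h3, ih]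
      push_cast; ring
  obtain ⟨n, hn⟩ := pow_unbounded_of_one_lt (1 / (leftTau β)^[N] 1) hβ
  rw [div_lt_iff₀ hp, ← key] at hn
  have : (leftTau β)^[N + n] 1 ≤ 1 := by
    cases h' : N + n with
    | zero => simp
    | succ k =>
      rw [Function.iterate_succ_apply']
      exact (leftTau_mem hβ (iterate_leftTau_pos hβ one_pos k)).2
  linarith

theorem quasiGreedyOne_lt_two {β : ℝ} (hβ : 1 < β) (hβ' : β ≤ 2) (n : ℕ) :
    quasiGreedyOne β n < 2 := by
  obtain ⟨y, h0, -, h1, -, h⟩ := exists_digit_eq_quasiGreedyOne hβ zero_lt_one (n + 1)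
  rw [← h n (by omega)]
  exact digit_lt_two hβ hβ' h0.le h1 n

/-! ### The order of the beta-shift -/

theorem quasiGreedyOne_mem {β : ℝ} (hβ : 1 < β) (hβ' : β ≤ 2) :
    (fun n => ⟨quasiGreedyOne β n, quasiGreedyOne_lt_two hβ hβ' n⟩ : ℕ → Fin 2) ∈ shiftSet β := by
  rw [mem_shiftSet_iff]
  intro N
  obtain ⟨y, h0, -, h1, hs, h⟩ := exists_digit_eq_quasiGreedyOne hβ zero_lt_one N
  exact ⟨fun n => ⟨digit β y n, digit_lt_two hβ hβ' h0.le h1 n⟩,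
    ⟨y, h0.le, h1.le, hs, fun _ => rfl⟩,
    fun m hm => Fin.ext (h m hm)⟩

/-- The quasi-greedy expansion of `1`, as a point of the beta-shift. -/
noncomputable def quasiGreedySeq {β : ℝ} (hβ : 1 < β) (hβ' : β ≤ 2) : Shift β :=
  ⟨_, quasiGreedyOne_mem hβ hβ'⟩

theorem quasiGreedySeq_val {β : ℝ} (hβ : 1 < β) (hβ' : β ≤ 2) (n : ℕ) :
    ((quasiGreedySeq hβ hβ').1 n : ℕ) = quasiGreedyOne β n := rfl

/-- A coded sequence above the quasi-greedy expansion would come from a number that exceeds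
numbers arbitrarily close to `1`, or from `1` itself; but if `1` is not simple, its greedy and
quasi-greedy expansions agree. -/
theorem le_quasiGreedySeq {β : ℝ} (hβ : 1 < β) (hβ' : β ≤ 2) (x : Shift β) :
    x ≤ quasiGreedySeq hβ hβ' := by
  by_contra! h
  obtain ⟨k, hk, hlt⟩ := lt_def.1 h
  obtain ⟨ω, ⟨u, hu0, hu1, hus, hud⟩, hux⟩ := mem_shiftSet_iff.1 x.2 (k + 1)
  have hxd : ∀ m < k + 1, digit β u m = (x.1 m : ℕ) := fun m hm => by rw [← hud, hux m hm]
  have he : ∀ m < k, quasiGreedyOne β m = digit β u m := fun m hm => by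
    rw [hxd m (by omega), ← hk m hm]; rfl
  have hl : quasiGreedyOne β k < digit β u k := by rw [hxd k (by omega)]; exact hlt
  rcases hu1.lt_or_eq with hu | rfl
  · obtain ⟨y, -, hy, -, -, hd⟩ := exists_digit_eq_quasiGreedyOne hβ hu (k + 1)
    refine hy.not_gt (lt_of_digit_lt hβ (n := k) (fun m hm => ?_) ?_)
    · rw [hd m (by omega), he m hm]
    · rw [hd k (by omega)]; exact hl
  · rw [quasiGreedyOne, dif_neg hus] at hl
    exact hl.false

theorem cons_zero_mem {β : ℝ} (hβ : 1 < β) (hβ' : β ≤ 2) (x : Shift β) :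
    cons 0 x.1 ∈ shiftSet β := by
  refine cons_mem_of_le hβ 0 (le_quasiGreedySeq hβ hβ' x) ?_
  rw [mem_shiftSet_iff]
  intro N
  obtain ⟨y, h0, -, h1, hs, h⟩ := exists_digit_eq_quasiGreedyOne hβ zero_lt_one N
  obtain ⟨a, b, c⟩ := cons_coded hβ 0 h0.le h1 hs fun _ => rfl
  simp only [Fin.val_zero, Nat.cast_zero, add_zero] at a b c
  have hlt : y / β < y := div_lt_self h0 hβ
  refine ⟨fun n => ⟨digit β (y / β) n, digit_lt_two hβ hβ' (by positivity) (hlt.trans h1) n⟩,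
    ⟨y / β, by positivity, (hlt.trans h1).le, a, fun _ => rfl⟩, fun m hm => Fin.ext ?_⟩
  cases m with
  | zero => exact c
  | succ m => exact (digit_tau β (y / β) m).symm.trans (by rw [b, h m (by omega)]; rfl)

theorem not_countable_shift {β : ℝ} (hβ : 1 < β) (hβ' : β ≤ 2) : ¬ Countable (Shift β) := by
  intro hc
  let s : Set ℝ := {x | (0 ≤ x ∧ x < 1) ∧ ¬ IsSimple β x}
  let f : s → Shift β := fun x => ⟨fun n => ⟨digit β x n, digit_lt_two hβ hβ' x.2.1.1 x.2.1.2 n⟩,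
    subset_closure ⟨x, x.2.1.1, x.2.1.2.le, x.2.2, fun _ => rfl⟩⟩
  have hf : Function.Injective f := fun x y h => Subtype.ext <|
    eq_of_digit_eq hβ x.2.1.1 x.2.1.2 y.2.1.1 y.2.1.2 fun n =>
      congrArg (fun z : Shift β => (z.1 n : ℕ)) h
  have hs : s.Countable := Set.countable_coe_iff.1 hf.countable
  have hI : (Set.Ico (0 : ℝ) 1).Countable := by
    refine Set.Countable.mono (fun x hx => ?_) (hs.union (countable_setOf_isSimple hβ))
    by_cases h : IsSimple β x
    · exact Or.inr h
    · exact Or.inl ⟨hx, h⟩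
  rw [← Cardinal.le_aleph0_iff_set_countable, Cardinal.mk_Ico_real zero_lt_one] at hI
  exact hI.not_gt Cardinal.aleph0_lt_continuum

/-- Replacing a tail of `w` by a smaller point of the shift. -/
theorem exists_replace_tail {β : ℝ} (hβ : 1 < β) (m : ℕ) : ∀ (w : Shift β) {x : Shift β},
    x ≤ (shift hβ)^[m] w →
      ∃ y ≤ w, (∀ i < m, y.1 i = w.1 i) ∧ ∀ i, y.1 (m + i) = x.1 i := by
  induction m with
  | zero => exact fun w x hx => ⟨x, hx, by simp, by simp⟩
  | succ m ih =>
    intro w x hx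
    obtain ⟨y, hy, h1, h2⟩ := ih (shift hβ w) hx
    have hw : cons (w.1 0) (shift hβ w).1 = w.1 := by
      funext n
      cases n <;> rfl
    have hw' : cons (w.1 0) (shift hβ w).1 ∈ shiftSet β := hw ▸ w.2
    have hy' := cons_mem_of_le hβ (w.1 0) hy hw'
    refine ⟨⟨_, hy'⟩, (cons_mono _ hy' hw' hy).trans_eq (Shift.ext hw), fun i hi => ?_, fun i => ?_⟩
    · cases i with
      | zero => rfl
      | succ i => exact h1 i (by omega)
    · rw [show m + 1 + i = (m + i) + 1 by omega]
      exact h2 i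

theorem shift_iterate_val {β : ℝ} (hβ : 1 < β) (m n : ℕ) (w : Shift β) :
    ((shift hβ)^[m] w).1 n = w.1 (m + n) := by
  induction m generalizing w with
  | zero => simp
  | succ m ih =>
    rw [Function.iterate_succ_apply, ih, show m + 1 + n = (m + n) + 1 by omega]
    rfl

/-- The points of the beta-shift with infinitely many digits `1`. -/
def infiniteOnes (β : ℝ) : Set (Shift β) := {w | ∀ N, ∃ n, N ≤ n ∧ w.1 n = 1}

theorem quasiGreedySeq_mem {β : ℝ} (hβ : 1 < β) (hβ' : β ≤ 2) :
    quasiGreedySeq hβ hβ' ∈ infiniteOnes β := by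
  intro N
  obtain ⟨n, hn, h⟩ := exists_quasiGreedyOne_ne_zero hβ N
  refine ⟨n, hn, Fin.ext ?_⟩
  have := quasiGreedyOne_lt_two hβ hβ' n
  rw [quasiGreedySeq_val, Fin.val_one]
  omega

theorem shift_mem_infiniteOnes {β : ℝ} (hβ : 1 < β) {w : Shift β} (hw : w ∈ infiniteOnes β) :
    shift hβ w ∈ infiniteOnes β := by
  intro N
  obtain ⟨n, hn, h⟩ := hw (N + 1)
  obtain ⟨n, rfl⟩ : ∃ k, n = k + 1 := ⟨n - 1, by omega⟩
  exact ⟨n, by omega, h⟩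

theorem countable_compl_infiniteOnes (β : ℝ) : (infiniteOnes β)ᶜ.Countable := by
  have h : (infiniteOnes β)ᶜ ⊆
      ⋃ N : ℕ, {w : Shift β | ∀ n, N ≤ n → w.1 n = 0} := by
    intro w hw
    simp only [infiniteOnes, Set.mem_compl_iff, Set.mem_ofPred_eq, not_forall, not_exists,
      not_and] at hw
    obtain ⟨N, hN⟩ := hw
    refine Set.mem_iUnion.2 ⟨N, fun n hn => ?_⟩
    have := hN n hn
    omega
  refine (Set.countable_iUnion fun N => Set.Finite.countable ?_).mono h
  refine Set.Finite.of_injOn (f := fun w : Shift β => fun i : Fin N => w.1 i) (t := Set.univ)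
    (fun _ _ => Set.mem_univ _) (fun w hw w' hw' e => Shift.ext (funext fun n => ?_))
    Set.finite_univ
  by_cases hn : n < N
  · exact congrFun e ⟨n, hn⟩
  · rw [hw n (by omega), hw' n (by omega)]

/-- Below a point `w` with infinitely many ones there are uncountably many points in every
interval: after a long prefix of `w`, replace a digit `1` by `0` and continue arbitrarily. -/
theorem not_countable_Ioo {β : ℝ} (hβ : 1 < β) (hβ' : β ≤ 2) {v w : Shift β}
    (hw : w ∈ infiniteOnes β) (hvw : v < w) : ¬ (Set.Ioo v w).Countable := by
  obtain ⟨k, hk, hlt⟩ := lt_def.1 hvw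
  obtain ⟨m, hm, h1⟩ := hw (k + 1)
  have hlt' : ∀ x : Shift β, (⟨cons 0 x.1, cons_zero_mem hβ hβ' x⟩ : Shift β) ≤
      (shift hβ)^[m] w := fun x => le_of_lt <| lt_def.2 ⟨0, by simp, by
        rw [shift_iterate_val, add_zero, h1]; exact Nat.zero_lt_one⟩
  choose f hf h2 h3 using fun x => exists_replace_tail hβ m w (hlt' x)
  have hinj : Function.Injective f := fun x y e => Shift.ext <| funext fun n => by
    have hx := h3 x (n + 1)
    rw [e, h3 y (n + 1)] at hx
    exact hx.symm
  intro hc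
  refine not_countable_shift hβ hβ' ?_
  have hmem : ∀ x, f x ∈ Set.Ioo v w := fun x => by
    refine ⟨lt_def.2 ⟨k, fun i hi => ?_, ?_⟩, lt_def.2 ⟨m, h2 x, ?_⟩⟩
    · rw [h2 x i (by omega), hk i hi]
    · rw [h2 x k (by omega)]; exact hlt
    · have := h3 x 0
      rw [add_zero] at this
      rw [this, h1]; exact Nat.zero_lt_one
  have : Countable (Set.Ioo v w) := hc
  exact Function.Injective.countable (f := fun x => (⟨f x, hmem x⟩ : Set.Ioo v w))
    fun x y e => hinj (congrArg Subtype.val e)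

/-- By compactness, a nonempty set has an upper bound that is approximated by its elements. -/
theorem exists_lub {β : ℝ} {S : Set (Shift β)} (hS : S.Nonempty) :
    ∃ w : Shift β, (∀ s ∈ S, s ≤ w) ∧ ∀ N, ∃ s ∈ S, ∀ m < N, s.1 m = w.1 m := by
  have := hS.to_subtype
  let K : S → Set (ℕ → Fin 2) := fun s => closure (Shift.seq '' {x | x ∈ S ∧ s.1 ≤ x})
  have happ : ∀ {s : S} {w : ℕ → Fin 2}, w ∈ K s →
      ∀ N, ∃ x ∈ S, s.1 ≤ x ∧ ∀ m < N, x.1 m = w m := by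
    intro s w hw N
    have ho : IsOpen {w' : ℕ → Fin 2 | ∀ m ∈ Set.Iio N, w' m = w m} := by
      have : {w' : ℕ → Fin 2 | ∀ m ∈ Set.Iio N, w' m = w m} =
          ⋂ m ∈ Set.Iio N, (fun w' : ℕ → Fin 2 => w' m) ⁻¹' {w m} := by ext; simp
      rw [this]
      exact (Set.finite_Iio N).isOpen_biInter fun m _ =>
        (isOpen_discrete _).preimage (continuous_apply m)
    obtain ⟨_, h1, x, ⟨hxS, hsx⟩, rfl⟩ := mem_closure_iff.1 hw _ ho (fun _ _ => rfl)
    exact ⟨x, hxS, hsx, h1⟩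
  have hmono : ∀ {s s' : S}, s.1 ≤ s'.1 → K s' ⊆ K s := fun h =>
    closure_mono (Set.image_mono fun x hx => ⟨hx.1, h.trans hx.2⟩)
  obtain ⟨w, hw⟩ := IsCompact.nonempty_iInter_of_directed_nonempty_isCompact_isClosed K
    (fun s s' => by
      rcases le_total s.1 s'.1 with h | h
      · exact ⟨s', hmono h, subset_rfl⟩
      · exact ⟨s, subset_rfl, hmono h⟩)
    (fun s => ⟨s.1.1, subset_closure ⟨s.1, ⟨s.2, le_rfl⟩, rfl⟩⟩)
    (fun s => isClosed_closure.isCompact) (fun s => isClosed_closure)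
  rw [Set.mem_iInter] at hw
  have hmem : w ∈ shiftSet β := by
    refine closure_minimal ?_ isClosed_closure (hw (Classical.arbitrary S))
    rintro _ ⟨x, -, rfl⟩
    exact x.2
  refine ⟨⟨w, hmem⟩, fun s hs => ?_, fun N => ?_⟩
  · by_contra! hlt
    obtain ⟨k, hk, hlk⟩ := lt_def.1 hlt
    obtain ⟨x, -, hsx, hx⟩ := happ (hw ⟨s, hs⟩) (k + 1)
    refine hsx.not_gt (lt_def.2 ⟨k, fun m hm => ?_, ?_⟩)
    · rw [hx m (by omega), ← hk m hm]
    · rw [hx k (by omega)]; exact hlk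
  · obtain ⟨x, hxS, -, hx⟩ := happ (hw (Classical.arbitrary S)) N
    exact ⟨x, hxS, hx⟩

/-- Up to a countable set, a lower set is empty or of the form `Iic w` with `w` having infinitely
many ones. The bound `w` is the supremum of the points of the lower set with infinitely many
ones; a sequence ending in zeros cannot be approximated by such points from below. -/
theorem isLowerSet_ae_eq {β : ℝ} {D : Set (Shift β)} (hD : IsLowerSet D) :
    D.Countable ∨ ∃ w ∈ infiniteOnes β, ∃ s : Set (Shift β), s.Countable ∧
      ∀ x ∉ s, (x ∈ D ↔ x ≤ w) := by
  have hY := countable_compl_infiniteOnes β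
  rcases (D ∩ infiniteOnes β).eq_empty_or_nonempty with h | h
  · exact Or.inl (hY.mono fun x hx => fun hxY => Set.notMem_empty x (h ▸ ⟨hx, hxY⟩))
  obtain ⟨w, hw1, hw2⟩ := exists_lub h
  refine Or.inr ⟨w, ?_, (infiniteOnes β)ᶜ ∪ {w}, hY.union (Set.countable_singleton w), ?_⟩
  · intro N
    by_contra! hN
    obtain ⟨s, hs, he⟩ := hw2 N
    refine (hw1 s hs).not_gt ?_
    classical
    obtain ⟨n, hn, hn1⟩ := hs.2 N
    have hex : ∃ n, N ≤ n ∧ s.1 n = 1 := ⟨n, hn, hn1⟩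
    refine lt_def.2 ⟨Nat.find hex, fun m hm => ?_, ?_⟩
    · rcases lt_or_ge m N with hmN | hmN
      · exact (he m hmN).symm
      · have h1 := hN m hmN
        have h2 := Nat.find_min hex hm
        have h3 : s.1 m ≠ 1 := fun h => h2 ⟨hmN, h⟩
        omega
    · have h1 := hN _ (Nat.find_spec hex).1
      rw [(Nat.find_spec hex).2]
      omega
  · intro x hx
    simp only [Set.mem_union, Set.mem_compl_iff, Set.mem_singleton_iff, not_or, not_not] at hx
    refine ⟨fun hxD => hw1 x ⟨hxD, hx.1⟩, fun hxw => ?_⟩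
    obtain ⟨k, hk, hlk⟩ := lt_def.1 (lt_of_le_of_ne hxw hx.2)
    obtain ⟨s, hs, he⟩ := hw2 (k + 1)
    refine hD (le_of_lt (lt_def.2 ⟨k, fun m hm => ?_, ?_⟩)) hs.1
    · rw [hk m hm, he m (by omega)]
    · rw [he k (by omega)]; exact hlk

/-! ### Jump coordinates on the space of step functions -/

section SummableCoordinates

variable {ι : Type*} {G : Type*} [NormedAddCommGroup G] [NormedSpace ℂ G]

theorem lp_one_hasSum_norm (a : lp (fun _ : ι => ℂ) 1) : HasSum (fun i => ‖a i‖) ‖a‖ := by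
  simpa using lp.hasSum_norm (by simp) a

theorem lp_one_hasSum_map [DecidableEq ι] (S : lp (fun _ : ι => ℂ) 1 →L[ℂ] G)
    (a : lp (fun _ : ι => ℂ) 1) : HasSum (fun i => a i • S (lp.single 1 i 1)) (S a) := by
  have h := (lp.hasSum_single (by simp) a).mapL S
  refine h.congr_fun fun i => ?_
  rw [← map_smul, ← lp.single_smul, smul_eq_mul, mul_one]

/-- An operator on `ℓ¹` is bounded by its values on the unit vectors. -/
theorem lp_one_opNorm_le [DecidableEq ι] (S : lp (fun _ : ι => ℂ) 1 →L[ℂ] G) {M : ℝ} (hM : 0 ≤ M)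
    (h : ∀ i, ‖S (lp.single 1 i 1)‖ ≤ M) : ‖S‖ ≤ M := by
  refine S.opNorm_le_bound hM fun a => ?_
  refine (lp_one_hasSum_map S a).norm_le_of_bounded ((lp_one_hasSum_norm a).mul_left M) fun i => ?_
  rw [norm_smul, mul_comm]
  gcongr
  exact h i

theorem lp_one_summable_mul (a : lp (fun _ : ι => ℂ) 1) {c : ι → ℂ} (hc : ∀ i, ‖c i‖ ≤ 1) :
    Summable fun i => a i * c i :=
  .of_norm_bounded (lp_one_hasSum_norm a).summable fun i => by
    rw [norm_mul]; exact mul_le_of_le_one_right (norm_nonneg _) (hc i)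

/-- The functional `a ↦ ∑ aᵢ cᵢ` on `ℓ¹` given by a sequence with `|cᵢ| ≤ 1`. -/
noncomputable def pairing (c : ι → ℂ) (hc : ∀ i, ‖c i‖ ≤ 1) : lp (fun _ : ι => ℂ) 1 →L[ℂ] ℂ :=
  LinearMap.mkContinuous
    { toFun := fun a => ∑' i, a i * c i
      map_add' := fun a b => by
        rw [← (lp_one_summable_mul a hc).tsum_add (lp_one_summable_mul b hc)]
        exact tsum_congr fun i => by rw [lp.coeFn_add, Pi.add_apply, add_mul]
      map_smul' := fun k a => by
        rw [RingHom.id_apply, smul_eq_mul, ← tsum_mul_left]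
        exact tsum_congr fun i => by rw [lp.coeFn_smul, Pi.smul_apply, smul_eq_mul, mul_assoc] }
    1 fun a => by
      rw [one_mul]
      refine (lp_one_summable_mul a hc).hasSum.norm_le_of_bounded (lp_one_hasSum_norm a) fun i => ?_
      rw [norm_mul]
      exact mul_le_of_le_one_right (norm_nonneg _) (hc i)

theorem pairing_apply (c : ι → ℂ) (hc : ∀ i, ‖c i‖ ≤ 1) (a : lp (fun _ : ι => ℂ) 1) :
    pairing c hc a = ∑' i, a i * c i := rfl

theorem pairing_single [DecidableEq ι] (c : ι → ℂ) (hc : ∀ i, ‖c i‖ ≤ 1) (i : ι) :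
    pairing c hc (lp.single 1 i 1) = c i := by
  rw [pairing_apply, tsum_eq_single i]
  · rw [lp.single_apply_self, one_mul]
  · intro j hj
    rw [lp.single_apply_ne _ _ _ hj, zero_mul]

end SummableCoordinates

/-- The space `ℓ¹(Y)` over the set `Y` of points with infinitely many ones. Such a point `w` is
the position of the jump of the indicator function of `Iic w`. -/
abbrev JumpSpace (β : ℝ) : Type := lp (fun _ : infiniteOnes β => ℂ) 1

/-- The indicator function of `Iic w`. -/
noncomputable def stepFun {β : ℝ} (w : Shift β) : Shift β → ℂ := (Set.Iic w).indicator 1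

theorem stepFun_of_le {β : ℝ} {w x : Shift β} (h : x ≤ w) : stepFun w x = 1 :=
  Set.indicator_of_mem (show x ∈ Set.Iic w from h) _

theorem stepFun_of_lt {β : ℝ} {w x : Shift β} (h : w < x) : stepFun w x = 0 :=
  Set.indicator_of_notMem (show x ∉ Set.Iic w from h.not_ge) _

theorem norm_stepFun_le {β : ℝ} (w x : Shift β) : ‖stepFun w x‖ ≤ 1 := by
  rcases le_or_gt x w with h | h
  · rw [stepFun_of_le h, norm_one]
  · rw [stepFun_of_lt h, norm_zero]; exact zero_le_one

theorem sum_enorm_stepFun_le {β : ℝ} (w : Shift β) {u : ℕ → Shift β} (hu : Monotone u) (n : ℕ) :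
    ∑ i ∈ Finset.range n, ‖stepFun w (u (i + 1)) - stepFun w (u i)‖ₑ ≤ 1 := by
  have h : ∀ i, ‖stepFun w (u (i + 1)) - stepFun w (u i)‖ₑ =
      ENNReal.ofReal ((stepFun w (u i)).re - (stepFun w (u (i + 1))).re) := by
    intro i
    have hi := hu (Nat.le_succ i)
    rcases le_or_gt (u (i + 1)) w with h1 | h1
    · rw [stepFun_of_le h1, stepFun_of_le (hi.trans h1)]; simp
    · rcases le_or_gt (u i) w with h2 | h2
      · rw [stepFun_of_lt h1, stepFun_of_le h2]; simp
      · rw [stepFun_of_lt h1, stepFun_of_lt h2]; simp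
  have hnn : ∀ i, 0 ≤ (stepFun w (u i)).re - (stepFun w (u (i + 1))).re := by
    intro i
    have hi := hu (Nat.le_succ i)
    rcases le_or_gt (u (i + 1)) w with h1 | h1
    · rw [stepFun_of_le h1, stepFun_of_le (hi.trans h1)]; simp
    · rcases le_or_gt (u i) w with h2 | h2
      · rw [stepFun_of_lt h1, stepFun_of_le h2]; simp
      · rw [stepFun_of_lt h1, stepFun_of_lt h2]; simp
  rw [Finset.sum_congr rfl fun i _ => h i, ← ENNReal.ofReal_sum_of_nonneg fun i _ => hnn i,
    Finset.sum_range_sub' (fun i => (stepFun w (u i)).re)]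
  rw [← ENNReal.ofReal_one]
  refine ENNReal.ofReal_le_ofReal ?_
  rcases le_or_gt (u n) w with h1 | h1
  · rw [stepFun_of_le h1, stepFun_of_le ((hu (Nat.zero_le n)).trans h1)]; simp
  · rcases le_or_gt (u 0) w with h2 | h2
    · rw [stepFun_of_lt h1, stepFun_of_le h2]; simp
    · rw [stepFun_of_lt h1, stepFun_of_lt h2]; simp

theorem var_pairing_stepFun_le {β : ℝ} (a : JumpSpace β) :
    var (fun x => pairing (fun w : infiniteOnes β => stepFun w.1 x)
      (fun w => norm_stepFun_le w.1 x) a) ≤ ENNReal.ofReal ‖a‖ := by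
  refine iSup_le fun ⟨n, u, hu, _⟩ => ?_
  have hs : ∀ x, Summable fun w : infiniteOnes β => a w * stepFun w.1 x :=
    fun x => lp_one_summable_mul a fun w => norm_stepFun_le w.1 x
  calc _ ≤ ∑ i ∈ Finset.range n, ∑' w : infiniteOnes β,
        ‖a w‖ₑ * ‖stepFun w.1 (u (i + 1)) - stepFun w.1 (u i)‖ₑ := by
        refine Finset.sum_le_sum fun i _ => ?_
        simp only [edist_eq_enorm_sub, pairing_apply]
        rw [← (hs _).tsum_sub (hs _)]
        refine (enorm_tsum_le_tsum_enorm).trans (le_of_eq (tsum_congr fun w => ?_))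
        rw [← mul_sub, enorm_mul]
    _ = ∑' w : infiniteOnes β, ‖a w‖ₑ *
        ∑ i ∈ Finset.range n, ‖stepFun w.1 (u (i + 1)) - stepFun w.1 (u i)‖ₑ := by
        rw [← Summable.tsum_finsetSum fun i _ => ENNReal.summable]
        exact tsum_congr fun w => (Finset.mul_sum _ _ _).symm
    _ ≤ ∑' w : infiniteOnes β, ‖a w‖ₑ := ENNReal.tsum_le_tsum fun w =>
        (mul_le_mul_right (sum_enorm_stepFun_le w.1 hu n) _).trans_eq (mul_one _)
    _ = ENNReal.ofReal ‖a‖ := by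
        rw [← (lp_one_hasSum_norm a).tsum_eq,
          ENNReal.ofReal_tsum_of_nonneg (fun _ => norm_nonneg _) (lp_one_hasSum_norm a).summable]
        exact tsum_congr fun w => (ofReal_norm _).symm

/-- The map `a ↦ ∑ a_w 1_{Iic w}` from `ℓ¹(Y)` to `BV`. -/
noncomputable def jumpSum (β : ℝ) : JumpSpace β →L[ℂ] BV β :=
  LinearMap.mkContinuous
    { toFun := fun a => ⟨fun x => pairing (fun w : infiniteOnes β => stepFun w.1 x)
        (fun w => norm_stepFun_le w.1 x) a,
        (var_pairing_stepFun_le a).trans_lt ENNReal.ofReal_lt_top⟩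
      map_add' := fun a b => BV.toFun_injective <| funext fun x => by
        change pairing _ (fun w => norm_stepFun_le w.1 x) (a + b) =
          pairing _ (fun w => norm_stepFun_le w.1 x) a + pairing _ _ b
        exact map_add _ _ _
      map_smul' := fun c a => BV.toFun_injective <| funext fun x => by
        change pairing _ (fun w => norm_stepFun_le w.1 x) (c • a) =
          c • pairing _ (fun w => norm_stepFun_le w.1 x) a
        exact map_smul _ _ _ }
    2 fun a => by
      change supNorm (fun x => pairing (fun w : infiniteOnes β => stepFun w.1 x)
        (fun w => norm_stepFun_le w.1 x) a) + (var (fun x => pairing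
          (fun w : infiniteOnes β => stepFun w.1 x) (fun w => norm_stepFun_le w.1 x) a)).toReal ≤ _
      rw [two_mul]
      refine add_le_add (Real.iSup_le (fun x => ?_) (norm_nonneg _)) ?_
      · refine ((pairing _ _).le_opNorm a).trans (mul_le_of_le_one_left (norm_nonneg _) ?_)
        exact LinearMap.mkContinuous_norm_le _ zero_le_one _
      · exact ENNReal.toReal_le_of_le_ofReal (norm_nonneg _) (var_pairing_stepFun_le a)

theorem jumpSum_toFun {β : ℝ} (a : JumpSpace β) (x : Shift β) :
    (jumpSum β a).toFun x = pairing (fun w : infiniteOnes β => stepFun w.1 x)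
        (fun w => norm_stepFun_le w.1 x) a := rfl

open Classical in
theorem jumpSum_single {β : ℝ} (w : infiniteOnes β) :
    (jumpSum β (lp.single 1 w 1)).toFun = stepFun w.1 :=
  funext fun x => by rw [jumpSum_toFun, pairing_single]

/-- The map `jumpSum` followed by the quotient map to `B`. -/
noncomputable def jumpSumB (β : ℝ) : JumpSpace β →L[ℂ] B β :=
  (nullSubmodule β).mkQL.comp (jumpSum β)

theorem jumpSumB_apply {β : ℝ} (a : JumpSpace β) :
    jumpSumB β a = (nullSubmodule β).mkQ (jumpSum β a) := rfl

/-- To the left of `w` and to the right of the finitely many smaller points of `s` there is a point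
outside a given countable set. -/
theorem exists_between_notMem {β : ℝ} (hβ : 1 < β) (hβ' : β ≤ 2) {C : Set (Shift β)}
    (hC : C.Countable) {w : Shift β} (hw : w ∈ infiniteOnes β) (s : Finset (Shift β)) :
    ∃ x ∉ C, x < w ∧ ∀ v ∈ s, v < w → v < x := by
  have hz : (fun _ => 0 : ℕ → Fin 2) ∈ shiftSet β := by
    refine subset_closure ⟨0, le_rfl, zero_le_one, ?_, fun n => ?_⟩
    all_goals
      have h0 : ∀ n, (tau β)^[n] 0 = 0 := fun n =>
        Function.iterate_fixed (by simp [tau]) n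
    · rintro ⟨n, k, hk, e⟩
      rw [h0, mul_zero] at e
      have : (k : ℝ) = 0 := e.symm
      rw [Nat.cast_eq_zero] at this
      omega
    · rw [digit, h0]; simp
  have hzw : (⟨_, hz⟩ : Shift β) < w := by
    classical
    have hex : ∃ n, w.1 n = 1 := (hw 0).imp fun n h => h.2
    refine lt_def.2 ⟨Nat.find hex, fun m hm => ?_, ?_⟩
    · have := Nat.find_min hex hm
      simp only
      omega
    · rw [Nat.find_spec hex]; exact Nat.zero_lt_one
  obtain ⟨v, hv, hmax⟩ := (insert (⟨_, hz⟩ : Shift β) (s.filter (· < w))).exists_max_image id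
    (Finset.insert_nonempty _ _)
  have hvw : v < w := by
    rcases Finset.mem_insert.1 hv with rfl | h
    · exact hzw
    · exact (Finset.mem_filter.1 h).2
  have hnc := not_countable_Ioo hβ hβ' hw hvw
  obtain ⟨x, hx, hxC⟩ : ∃ x ∈ Set.Ioo v w, x ∉ C := by
    by_contra! h
    exact hnc (hC.mono h)
  exact ⟨x, hxC, hx.2, fun y hy hyw => (hmax y (Finset.mem_insert_of_mem
    (Finset.mem_filter.2 ⟨hy, hyw⟩))).trans_lt hx.1⟩

/-- The jumps of a step function contribute to its variation even after a modification on a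
countable set, because they can be seen from uncountably many points on either side. -/
theorem sum_norm_le_of_ae_eq {β : ℝ} (hβ : 1 < β) (hβ' : β ≤ 2) {m : ℕ}
    {e : Fin (m + 1) → infiniteOnes β} (he : StrictMono e) (c : Fin (m + 1) → ℂ) (g : BV β)
    {C : Set (Shift β)} (hC : C.Countable)
    (hg : ∀ x ∉ C, g.toFun x = ∑ j, c j * stepFun (e j).1 x) : ∑ j, ‖c j‖ ≤ ‖g‖ := by
  classical
  choose x hxC hx1 hx2 using fun i : Fin (m + 1) =>
    exists_between_notMem hβ hβ' hC (e i).2 (Finset.univ.image fun j => (e j).1)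
  have hge : ∀ i j, i ≤ j → stepFun (e j).1 (x i) = 1 := fun i j hij =>
    stepFun_of_le ((hx1 i).le.trans (he.monotone hij))
  have hlt : ∀ i j, j < i → stepFun (e j).1 (x i) = 0 := fun i j hij =>
    stepFun_of_lt (hx2 i _ (Finset.mem_image_of_mem _ (Finset.mem_univ j)) (he hij))
  have hmono : Monotone x := by
    intro i j hij
    rcases hij.eq_or_lt with rfl | hij
    · exact le_rfl
    · exact (hx1 i).le.trans (hx2 j _ (Finset.mem_image_of_mem _ (Finset.mem_univ i)) (he hij)).le
  let p : ℕ → Fin (m + 1) := fun k => ⟨min k m, by omega⟩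
  have hp : Monotone p := fun a b hab => Fin.mk_le_mk.2 (min_le_min_right m hab)
  have hlast : c (Fin.last m) = g.toFun (x (Fin.last m)) := by
    rw [hg _ (hxC _), Finset.sum_eq_single (Fin.last m)]
    · rw [hge _ _ le_rfl, mul_one]
    · intro j _ hj
      rw [hlt _ _ (lt_of_le_of_ne (Fin.le_last j) hj), mul_zero]
    · simp
  have hstep : ∀ k : Fin m, c k.castSucc = g.toFun (x (p k)) - g.toFun (x (p (k + 1))) := by
    intro k
    have h1 : p k = k.castSucc := Fin.ext (min_eq_left k.2.le)
    have h2 : p (k + 1) = k.succ := Fin.ext (min_eq_left k.2)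
    rw [h1, h2, hg _ (hxC _), hg _ (hxC _), ← Finset.sum_sub_distrib,
      Finset.sum_eq_single k.castSucc]
    · rw [hge _ _ le_rfl, hlt _ _ Fin.castSucc_lt_succ, mul_one, mul_zero, sub_zero]
    · intro j _ hj
      rcases lt_or_gt_of_ne hj with h | h
      · rw [hlt _ _ h, hlt _ _ (h.trans Fin.castSucc_lt_succ), sub_self]
      · rw [hge _ _ h.le, hge _ _ (Fin.castSucc_lt_iff_succ_le.1 h), sub_self]
    · simp
  have hvar : ∑ k : Fin m, ‖c k.castSucc‖ ≤ (var g.toFun).toReal := by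
    have h1 : ∑ i ∈ Finset.range m, edist (g.toFun (x (p (i + 1)))) (g.toFun (x (p i))) ≤
        var g.toFun := eVariationOn.sum_le (u := fun i => x (p i)) (hmono.comp hp)
          fun _ => Set.mem_univ _
    have h2 := ENNReal.toReal_mono g.var_ne_top h1
    rw [ENNReal.toReal_sum fun i _ => edist_ne_top _ _, Finset.sum_range] at h2
    refine le_trans (le_of_eq (Finset.sum_congr rfl fun k _ => ?_)) h2
    rw [hstep, ← dist_eq_norm, dist_comm, dist_edist]
  rw [Fin.sum_univ_castSucc, BV.norm_def, add_comm]
  refine add_le_add ?_ hvar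
  rw [hlast]
  exact g.le_supNorm _

/-- On finite sums of jumps this is `sum_norm_le_of_ae_eq`, applied to representatives in `BV` of
almost minimal norm; the general case follows by density. -/
theorem norm_le_norm_jumpSumB {β : ℝ} (hβ : 1 < β) (hβ' : β ≤ 2) (a : JumpSpace β) :
    ‖a‖ ≤ ‖jumpSumB β a‖ := by
  classical
  have hfin : ∀ s : Finset (infiniteOnes β), ‖∑ w ∈ s, lp.single (E := fun _ => ℂ) 1 w (a w)‖ ≤
      ‖jumpSumB β (∑ w ∈ s, lp.single 1 w (a w))‖ := by
    intro s
    have hn : ‖∑ w ∈ s, lp.single (E := fun _ => ℂ) 1 w (a w)‖ = ∑ w ∈ s, ‖a w‖ := by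
      simpa using lp.norm_sum_single (p := 1) (E := fun _ : infiniteOnes β => ℂ) (by simp) a s
    rw [hn]
    rcases s.eq_empty_or_nonempty with rfl | hs
    · simp
    refine le_of_forall_pos_le_add fun ε hε => ?_
    obtain ⟨g, hg, hgn⟩ := Submodule.Quotient.norm_mk_lt
      (jumpSumB β (∑ w ∈ s, lp.single 1 w (a w))) hε
    refine le_trans ?_ hgn.le
    obtain ⟨C, hC, hz⟩ := (Submodule.Quotient.eq (nullSubmodule β)).1
      (hg.trans (jumpSumB_apply _))
    obtain ⟨m, hm⟩ : ∃ m, s.card = m + 1 := ⟨s.card - 1, by have := hs.card_pos; omega⟩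
    have hval : ∀ x, (jumpSum β (∑ w ∈ s, lp.single 1 w (a w))).toFun x =
        ∑ w ∈ s, a w * stepFun w.1 x := by
      intro x
      rw [jumpSum_toFun, map_sum]
      refine Finset.sum_congr rfl fun w _ => ?_
      rw [← pairing_single (fun w : infiniteOnes β => stepFun w.1 x)
        (fun w => norm_stepFun_le w.1 x) w, ← smul_eq_mul, ← map_smul, ← lp.single_smul,
        smul_eq_mul, mul_one]
    have hreindex : ∀ {M : Type} [AddCommMonoid M] (F : infiniteOnes β → M),
        ∑ w ∈ s, F w = ∑ j, F (s.orderEmbOfFin hm j) := by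
      intro M _ F
      rw [← Finset.sum_coe_sort s, ← Equiv.sum_comp (s.orderIsoOfFin hm).toEquiv]
      exact Finset.sum_congr rfl fun j _ => rfl
    rw [hreindex]
    refine sum_norm_le_of_ae_eq hβ hβ' (s.orderEmbOfFin hm).strictMono _ g hC fun x hx => ?_
    have h1 := hz x hx
    rw [map_sub, Pi.sub_apply, sub_eq_zero, hval, hreindex] at h1
    exact h1
  have h1 := lp.hasSum_single (by simp) a
  exact le_of_tendsto_of_tendsto' h1.norm
    (((jumpSumB β).continuous.tendsto a).comp h1).norm hfin

theorem jumpSumB_mem {β : ℝ} (a : JumpSpace β) : jumpSumB β a ∈ stepClosure β := by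
  classical
  refine (stepSubmodule β).isClosed_topologicalClosure.mem_of_tendsto
    (lp_one_hasSum_map (jumpSumB β) a) (Eventually.of_forall fun s => ?_)
  refine sum_mem fun w _ => Submodule.smul_mem _ _ ?_
  exact (stepSubmodule β).le_topologicalClosure (Submodule.subset_span
    ⟨Set.Iic w.1, jumpSum β (lp.single 1 w 1), Set.ordConnected_Iic, jumpSum_single w, rfl⟩)

theorem exists_jumpSum_ae_eq {β : ℝ} {D : Set (Shift β)} (hD : IsLowerSet D) :
    ∃ a : JumpSpace β, ∃ s : Set (Shift β), s.Countable ∧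
      ∀ x ∉ s, (jumpSum β a).toFun x = D.indicator 1 x := by
  classical
  rcases isLowerSet_ae_eq hD with h | ⟨w, hw, s, hs, h⟩
  · exact ⟨0, D, h, fun x hx => by rw [map_zero, map_zero, Set.indicator_of_notMem hx]; rfl⟩
  · refine ⟨lp.single 1 ⟨w, hw⟩ 1, s, hs, fun x hx => ?_⟩
    rw [jumpSum_single]
    by_cases hxD : x ∈ D
    · rw [stepFun_of_le ((h x hx).1 hxD), Set.indicator_of_mem hxD]; rfl
    · rw [stepFun_of_lt (lt_of_not_ge fun h' => hxD ((h x hx).2 h')),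
        Set.indicator_of_notMem hxD]

theorem stepClosure_le_range {β : ℝ} (hβ : 1 < β) (hβ' : β ≤ 2) :
    stepClosure β ≤ (jumpSumB β).range := by
  refine Submodule.topologicalClosure_minimal _ (Submodule.span_le.2 ?_) ?_
  · rintro _ ⟨I, f, hI, hf, rfl⟩
    -- an order-convex set is the difference of two lower sets
    let D : Set (Shift β) := {x | ∃ y ∈ I, x ≤ y}
    have hD : IsLowerSet D := fun x y hxy ⟨z, hz, h⟩ => ⟨z, hz, hxy.trans h⟩
    have hD' : IsLowerSet (D \ I) := by
      rintro x y hyx ⟨⟨z, hz, hxz⟩, hxI⟩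
      exact ⟨⟨z, hz, hyx.trans hxz⟩, fun hyI => hxI (hI.out hyI hz ⟨hyx, hxz⟩)⟩
    obtain ⟨a, s, hs, ha⟩ := exists_jumpSum_ae_eq hD
    obtain ⟨b, s', hs', hb⟩ := exists_jumpSum_ae_eq hD'
    refine ⟨a - b, ?_⟩
    refine (Submodule.Quotient.eq (nullSubmodule β)).2 ⟨s ∪ s', hs.union hs', fun x hx => ?_⟩
    rw [Set.mem_union, not_or] at hx
    rw [map_sub, map_sub, map_sub, Pi.sub_apply, Pi.sub_apply, ContinuousLinearMap.coe_coe,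
      ha x hx.1, hb x hx.2, hf]
    by_cases hxI : x ∈ I
    · have hxD : x ∈ D := ⟨x, hxI, le_rfl⟩
      rw [Set.indicator_of_mem hxI, Set.indicator_of_mem hxD,
        Set.indicator_of_notMem fun h => h.2 hxI]
      simp
    · by_cases hxD : x ∈ D
      · rw [Set.indicator_of_notMem hxI, Set.indicator_of_mem hxD,
          Set.indicator_of_mem (show x ∈ D \ I from ⟨hxD, hxI⟩)]
        simp
      · rw [Set.indicator_of_notMem hxI, Set.indicator_of_notMem hxD,
          Set.indicator_of_notMem fun h => hxD h.1]
        simp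
  · have h : AntilipschitzWith 1 (jumpSumB β) :=
      (jumpSumB β).antilipschitz_of_bound fun a => by
        simpa using norm_le_norm_jumpSumB hβ hβ' a
    exact h.isClosed_range (jumpSumB β).uniformContinuous

/-- The space `F` is isomorphic to `ℓ¹(Y)`. -/
noncomputable def jumpEquiv {β : ℝ} (hβ : 1 < β) (hβ' : β ≤ 2) :
    JumpSpace β ≃L[ℂ] stepClosure β :=
  let T : JumpSpace β →L[ℂ] stepClosure β := (jumpSumB β).codRestrict _ jumpSumB_mem
  have hT : ∀ a, ‖a‖ ≤ ‖T a‖ := norm_le_norm_jumpSumB hβ hβ'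
  let e : JumpSpace β ≃ₗ[ℂ] stepClosure β := LinearEquiv.ofBijective T.toLinearMap
    ⟨(injective_iff_map_eq_zero T).2 fun a ha => norm_le_zero_iff.1 <| by
        simpa [ha] using hT a,
      fun b => (stepClosure_le_range hβ hβ' b.2).imp fun _ h => Subtype.ext h⟩
  { e with
    continuous_toFun := T.continuous
    continuous_invFun := AddMonoidHomClass.continuous_of_bound e.symm 1 fun b => by
      simpa [e] using (hT (e.symm b)).trans_eq
        (congrArg norm (LinearEquiv.apply_symm_apply e b)) }

/-! ### The transfer operator in jump coordinates -/

section Conjugation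

variable {E G : Type*} [NormedAddCommGroup E] [NormedSpace ℂ E] [NormedAddCommGroup G]
  [NormedSpace ℂ G]

theorem isIsolatedEigenvalue_conj (e : E ≃L[ℂ] G) (K : E →L[ℂ] E) (l : ℂ) :
    IsIsolatedEigenvalue (e.conjContinuousAlgEquiv K) l ↔ IsIsolatedEigenvalue K l := by
  have hs : spectrum ℂ (e.conjContinuousAlgEquiv K) = spectrum ℂ K :=
    AlgEquiv.spectrum_eq e.conjContinuousAlgEquiv.toAlgEquiv K
  rw [IsIsolatedEigenvalue, IsIsolatedEigenvalue, hs]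
  refine and_congr_left fun _ => ⟨?_, ?_⟩
  · rintro ⟨v, hv, h⟩
    refine ⟨e.symm v, by simpa using hv, ?_⟩
    rw [ContinuousLinearEquiv.conjContinuousAlgEquiv_apply_apply] at h
    rw [← map_smul, ← h, e.symm_apply_apply]
  · rintro ⟨v, hv, h⟩
    refine ⟨e v, by simpa using hv, ?_⟩
    rw [ContinuousLinearEquiv.conjContinuousAlgEquiv_apply_apply, e.symm_apply_apply, h, map_smul]

end Conjugation

/-- If `w` starts with `1`, every `0x` lies below `w`, which gives the constant function, and the
`1x` below `w` are those with `x ≤ σ w`; if `w` starts with `0`, only the branch `0x` counts. -/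
theorem branchFun_stepFun {β : ℝ} (hβ : 1 < β) (hβ' : β ≤ 2) (t : ℝ) (w x : Shift β) :
    branchFun 0 (stepFun w) x + (Real.exp t : ℂ) * branchFun 1 (stepFun w) x =
      ((w.1 0 : ℕ) : ℂ) + (Real.exp ((w.1 0 : ℕ) * t) : ℂ) * stepFun (shift hβ w) x := by
  have hw : cons (w.1 0) (shift hβ w).1 = w.1 := by
    funext n
    cases n <;> rfl
  have hw' : cons (w.1 0) (shift hβ w).1 ∈ shiftSet β := hw ▸ w.2
  have hww : w = ⟨_, hw'⟩ := Shift.ext hw.symm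
  have hle : ∀ h : cons (w.1 0) x.1 ∈ shiftSet β, x ≤ shift hβ w → (⟨_, h⟩ : Shift β) ≤ w :=
    fun h hx => (cons_mono _ h hw' hx).trans_eq hww.symm
  have hgt : ∀ h : cons (w.1 0) x.1 ∈ shiftSet β, shift hβ w < x → w < ⟨_, h⟩ := by
    intro h hx
    obtain ⟨k, hk, hlk⟩ := lt_def.1 hx
    refine lt_def.2 ⟨k + 1, fun m hm => ?_, hlk⟩
    cases m with
    | zero => rfl
    | succ m => exact hk m (by omega)
  have h0 := cons_zero_mem hβ hβ' x
  rw [branchFun, dif_pos h0]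
  rcases (by omega : w.1 0 = 0 ∨ w.1 0 = 1) with hd | hd
  · rw [hd] at hle hgt
    have h1 : branchFun 1 (stepFun w) x = 0 := by
      rw [branchFun]
      split_ifs with h
      · refine stepFun_of_lt (lt_def.2 ⟨0, by simp, ?_⟩)
        rw [hd]; exact Nat.zero_lt_one
      · rfl
    rw [h1, hd]
    rcases le_or_gt x (shift hβ w) with hx | hx
    · rw [stepFun_of_le hx, stepFun_of_le (hle h0 hx)]; simp
    · rw [stepFun_of_lt hx, stepFun_of_lt (hgt h0 hx)]; simp
  · have h1 : (⟨cons 0 x.1, h0⟩ : Shift β) ≤ w := le_of_lt <| lt_def.2 ⟨0, by simp, by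
      rw [hd]; exact Nat.zero_lt_one⟩
    rw [stepFun_of_le h1, branchFun]
    rw [hd] at hle hgt hw'
    rcases le_or_gt x (shift hβ w) with hx | hx
    · have h := cons_mem_of_le hβ 1 hx hw'
      rw [dif_pos h, stepFun_of_le hx, stepFun_of_le (hle h hx), hd]; simp
    · rw [stepFun_of_lt hx, hd]
      split_ifs with h
      · rw [stepFun_of_lt (hgt h hx)]; simp
      · simp

/-- The shift on the points with infinitely many ones. -/
def shiftOnes {β : ℝ} (hβ : 1 < β) (w : infiniteOnes β) : infiniteOnes β :=
  ⟨shift hβ w.1, shift_mem_infiniteOnes hβ w.2⟩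

/-- The quasi-greedy expansion of `1` as a jump position; the indicator function of the points up
to it is the constant `1`. -/
noncomputable def topOnes {β : ℝ} (hβ : 1 < β) (hβ' : β ≤ 2) : infiniteOnes β :=
  ⟨_, quasiGreedySeq_mem hβ hβ'⟩

theorem shiftOnes_iterate_val {β : ℝ} (hβ : 1 < β) (n : ℕ) (w : infiniteOnes β) :
    ((shiftOnes hβ)^[n] w).1 = (shift hβ)^[n] w.1 := by
  induction n generalizing w with
  | zero => rfl
  | succ n ih => rw [Function.iterate_succ_apply, Function.iterate_succ_apply, ih]; rfl

open Classical in
/-- The unit vector of `ℓ¹(Y)` at `w`. -/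
noncomputable def unitJump {β : ℝ} (w : infiniteOnes β) : JumpSpace β := lp.single 1 w 1

theorem norm_unitJump {β : ℝ} (w : infiniteOnes β) : ‖unitJump w‖ = 1 := by
  classical
  rw [unitJump, lp.norm_single (by simp), norm_one]

/-- The first digit as a functional on jumps. -/
noncomputable def firstDigit (β : ℝ) : JumpSpace β →L[ℂ] ℂ :=
  pairing (fun w => ((w.1.1 0 : ℕ) : ℂ)) fun w => by
    have : (w.1.1 0 : ℕ) ≤ 1 := by omega
    rw [Complex.norm_natCast]
    exact_mod_cast this

theorem firstDigit_unitJump {β : ℝ} (w : infiniteOnes β) :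
    firstDigit β (unitJump w) = ((w.1.1 0 : ℕ) : ℂ) := by
  classical
  exact pairing_single _ _ w

/-- The transfer operator in jump coordinates. -/
noncomputable def jumpTransfer {β : ℝ} (hβ : 1 < β) (hβ' : β ≤ 2) (t : ℝ) :
    JumpSpace β →L[ℂ] JumpSpace β :=
  (jumpEquiv hβ hβ').symm.conjContinuousAlgEquiv (transfer hβ t)

/-- The part of the transfer operator that moves the jump at `w` to `σ w`, with a weight. -/
noncomputable def weightedShift {β : ℝ} (hβ : 1 < β) (hβ' : β ≤ 2) (t : ℝ) :
    JumpSpace β →L[ℂ] JumpSpace β :=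
  jumpTransfer hβ hβ' t - (firstDigit β).smulRight (unitJump (topOnes hβ hβ'))

theorem jumpTransfer_unitJump {β : ℝ} (hβ : 1 < β) (hβ' : β ≤ 2) (t : ℝ) (w : infiniteOnes β) :
    jumpTransfer hβ hβ' t (unitJump w) = ((w.1.1 0 : ℕ) : ℂ) • unitJump (topOnes hβ hβ') +
      (Real.exp ((w.1.1 0 : ℕ) * t) : ℂ) • unitJump (shiftOnes hβ w) := by
  rw [jumpTransfer, ContinuousLinearEquiv.conjContinuousAlgEquiv_apply_apply,
    ContinuousLinearEquiv.symm_symm, ContinuousLinearEquiv.symm_apply_eq]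
  refine Subtype.ext ?_
  change transferB hβ t ((nullSubmodule β).mkQ (jumpSum β (unitJump w))) =
    (nullSubmodule β).mkQ (jumpSum β _)
  rw [transferB_mk]
  congr 1
  refine BV.toFun_injective (funext fun x => ?_)
  have h1 : ∀ v : infiniteOnes β, (jumpSum β (unitJump v)).toFun = stepFun v.1 :=
    fun v => jumpSum_single v
  rw [transferBV_eq]
  simp only [map_add, map_smul, Pi.add_apply, Pi.smul_apply, h1]
  change branchFun 0 (jumpSum β (unitJump w)).toFun x +
    (Real.exp t : ℂ) * branchFun 1 (jumpSum β (unitJump w)).toFun x = _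
  rw [h1, branchFun_stepFun hβ hβ',
    stepFun_of_le (show x ≤ (topOnes hβ hβ').1 from le_quasiGreedySeq hβ hβ' x)]
  simp [shiftOnes]

theorem weightedShift_unitJump {β : ℝ} (hβ : 1 < β) (hβ' : β ≤ 2) (t : ℝ) (w : infiniteOnes β) :
    weightedShift hβ hβ' t (unitJump w) =
      (Real.exp ((w.1.1 0 : ℕ) * t) : ℂ) • unitJump (shiftOnes hβ w) := by
  rw [weightedShift, sub_apply, jumpTransfer_unitJump, ContinuousLinearMap.smulRight_apply,
    firstDigit_unitJump, add_sub_cancel_left]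

theorem weightedShift_pow_unitJump {β : ℝ} (hβ : 1 < β) (hβ' : β ≤ 2) (t : ℝ) (n : ℕ)
    (w : infiniteOnes β) : (weightedShift hβ hβ' t ^ n) (unitJump w) =
      (Real.exp ((∑ i ∈ Finset.range n, ((w.1.1 i : ℕ) : ℝ)) * t) : ℂ) •
        unitJump ((shiftOnes hβ)^[n] w) := by
  induction n with
  | zero => simp
  | succ n ih =>
    rw [pow_succ', mul_apply_eq_comp, ih, map_smul, weightedShift_unitJump, smul_smul,
      shiftOnes_iterate_val, shift_iterate_val, ← Function.iterate_succ_apply' (shiftOnes hβ),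
      ← Complex.ofReal_mul, ← Real.exp_add, Finset.sum_range_succ, add_mul, add_zero]

/-! ### Growth of the weights -/

theorem birkhoff_potential {β : ℝ} (hβ : 1 < β) (t : ℝ) (n : ℕ) (x : Shift β) :
    birkhoff hβ (potential t) n x = (∑ i ∈ Finset.range n, ((x.1 i : ℕ) : ℝ)) * t := by
  rw [birkhoff, Finset.sum_mul]
  refine Finset.sum_congr rfl fun i _ => ?_
  have h := shift_iterate_val hβ i 0 x
  rw [add_zero] at h
  rw [← h, potential]
  generalize (shift hβ)^[i] x = y
  rcases (by omega : y.1 0 = 0 ∨ y.1 0 = 1) with hd | hd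
  · rw [Set.indicator_of_notMem (by simp [hd]), hd]; simp
  · rw [Set.indicator_of_mem (by simp [hd]), hd]; simp

theorem birkhoff_potential_le {β : ℝ} (hβ : 1 < β) (t : ℝ) (n : ℕ) (x : Shift β) :
    birkhoff hβ (potential t) n x ≤ n * |t| := by
  rw [birkhoff_potential, Finset.sum_mul]
  refine (Finset.sum_le_card_nsmul _ _ |t| fun i _ => ?_).trans_eq (by simp)
  have h1 : ((x.1 i : ℕ) : ℝ) ≤ 1 := by exact_mod_cast (by omega : (x.1 i : ℕ) ≤ 1)
  calc ((x.1 i : ℕ) : ℝ) * t ≤ ((x.1 i : ℕ) : ℝ) * |t| := by gcongr; exact le_abs_self t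
    _ ≤ _ := mul_le_of_le_one_left (abs_nonneg t) h1

/-- Any number above `r_t` bounds the exponential growth rate of the weights, uniformly. -/
theorem exists_exp_birkhoff_le {β : ℝ} (hβ : 1 < β) {t r : ℝ} (hr : rt hβ t < r) :
    ∃ ρ, 0 < ρ ∧ ρ < r ∧ ∃ C, 0 ≤ C ∧
      ∀ n x, Real.exp (birkhoff hβ (potential t) n x) ≤ C * ρ ^ n := by
  obtain ⟨ρ, hρ, hρr⟩ := exists_between hr
  have hbdd : ∀ n, BddAbove (Set.range (birkhoff hβ (potential t) n)) := fun n =>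
    ⟨n * |t|, by rintro _ ⟨x, rfl⟩; exact birkhoff_potential_le hβ t n x⟩
  have hub : IsBoundedUnder (· ≤ ·) atTop
      (fun n : ℕ => Real.exp (⨆ x, birkhoff hβ (potential t) n x) ^ (1 / (n : ℝ))) := by
    refine isBoundedUnder_of ⟨Real.exp |t|, fun n => ?_⟩
    rcases Nat.eq_zero_or_pos n with rfl | hn
    · simp
    · have h1 : (⨆ x, birkhoff hβ (potential t) n x) ≤ n * |t| :=
        Real.iSup_le (birkhoff_potential_le hβ t n) (by positivity)
      have hn' : (n : ℝ) ≠ 0 := by positivity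
      rw [← Real.exp_mul, Real.exp_le_exp, mul_one_div, div_le_iff₀ (by positivity), mul_comm |t|]
      exact h1
  obtain ⟨N, hN⟩ := eventually_atTop.1 (eventually_lt_of_limsup_lt hρ hub)
  have hρ0 : 0 < ρ := (by positivity : (0 : ℝ) ≤ _).trans_lt (hN N le_rfl)
  have hpos : ∀ n : ℕ, 0 ≤ Real.exp (n * |t|) / ρ ^ n := fun n => by positivity
  have hsum := Finset.sum_nonneg fun n (_ : n ∈ Finset.range (N + 1)) => hpos n
  -- the sum absorbs the finitely many `n` at which the root bound may still fail
  refine ⟨ρ, hρ0, hρr, 1 + ∑ n ∈ Finset.range (N + 1), Real.exp (n * |t|) / ρ ^ n,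
    by positivity, fun n x => ?_⟩
  rcases lt_or_ge n (N + 1) with h | h
  · have h1 : Real.exp (n * |t|) / ρ ^ n ≤
        1 + ∑ n ∈ Finset.range (N + 1), Real.exp (n * |t|) / ρ ^ n :=
      (Finset.single_le_sum (fun n _ => hpos n) (Finset.mem_range.2 h)).trans (by linarith)
    rw [div_le_iff₀ (by positivity)] at h1
    exact (Real.exp_le_exp.2 (birkhoff_potential_le hβ t n x)).trans h1
  · have h1 := hN n (by omega)
    have h2 := pow_le_pow_left₀ (by positivity) h1.le n
    rw [one_div, Real.rpow_inv_natCast_pow (by positivity) (by omega)] at h2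
    refine (Real.exp_le_exp.2 (le_ciSup (hbdd n) x)).trans (h2.trans ?_)
    exact le_mul_of_one_le_left (by positivity) (by linarith)

theorem norm_weightedShift_pow_le {β : ℝ} (hβ : 1 < β) (hβ' : β ≤ 2) {t C ρ : ℝ} (hC : 0 ≤ C)
    (hρ : 0 < ρ) (h : ∀ n x, Real.exp (birkhoff hβ (potential t) n x) ≤ C * ρ ^ n) (n : ℕ) :
    ‖weightedShift hβ hβ' t ^ n‖ ≤ C * ρ ^ n := by
  classical
  refine lp_one_opNorm_le _ (by positivity) fun w => ?_
  have h1 := weightedShift_pow_unitJump hβ hβ' t n w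
  rw [unitJump] at h1
  rw [h1, norm_smul, norm_unitJump, mul_one, Complex.norm_real, Real.norm_of_nonneg (by positivity),
    ← birkhoff_potential hβ]
  exact h n w.1

theorem phiTerm_eq {β : ℝ} (hβ : 1 < β) (hβ' : β ≤ 2) (t : ℝ) (z : ℂ) (n : ℕ) :
    phiTerm β t z n = firstDigit β ((weightedShift hβ hβ' t ^ n) (unitJump (topOnes hβ hβ'))) *
      z ^ (n + 1) := by
  have h : ∀ i, ((topOnes hβ hβ').1.1 i : ℕ) = quasiGreedyOne β i := fun i => rfl
  rw [weightedShift_pow_unitJump, map_smul, firstDigit_unitJump, shiftOnes_iterate_val,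
    shift_iterate_val, add_zero, phiTerm, smul_eq_mul]
  simp only [h]
  ring

end BetaTransfer

theorem theorem3p6 (β : ℝ) (hβ : 1 < β) (hβ' : β ≤ 2) (t : ℝ) (l : ℂ)
    (hl : BetaTransfer.rt hβ t < ‖l‖) :
    Summable (BetaTransfer.phiTerm β t l⁻¹) ∧
      (BetaTransfer.IsIsolatedEigenvalue (E := BetaTransfer.stepClosure β)
          (BetaTransfer.transfer hβ t) l ↔
        1 - BetaTransfer.phi β t l⁻¹ = 0) := by
  open BetaTransfer in
  obtain ⟨ρ, hρ, hρl, C, hC, hb⟩ := exists_exp_birkhoff_le hβ hl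
  have hA := norm_weightedShift_pow_le hβ hβ' hC hρ hb
  have hphi := phiTerm_eq hβ hβ' t l⁻¹
  have hz : ‖l⁻¹‖ * ρ < 1 := by rwa [norm_inv, inv_mul_lt_one₀ (hρ.trans hρl)]
  constructor
  · have hs := ((summable_smul_pow hρ hA hz).mapL (ContinuousLinearMap.apply ℂ (JumpSpace β)
      (unitJump (topOnes hβ hβ')))).mapL (firstDigit β)
    refine (hs.mul_left l⁻¹).congr fun n => ?_
    rw [hphi, ContinuousLinearMap.apply_apply, smul_pow, smul_apply, map_smul, smul_eq_mul]
    ring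
  · have he : unitJump (topOnes hβ hβ') ≠ 0 := fun h => by
      have := norm_unitJump (topOnes hβ hβ')
      rw [h, norm_zero] at this
      exact zero_ne_one this
    have hK : jumpTransfer hβ hβ' t = weightedShift hβ hβ' t +
        (firstDigit β).smulRight (unitJump (topOnes hβ hβ')) := (sub_add_cancel _ _).symm
    have hphi' : phi β t l⁻¹ =
        rankOneSeries (weightedShift hβ hβ' t) (firstDigit β) (unitJump (topOnes hβ hβ')) l⁻¹ :=
      tsum_congr hphi
    rw [← isIsolatedEigenvalue_conj (jumpEquiv hβ hβ').symm, ← jumpTransfer, hK,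
      isIsolatedEigenvalue_iff_rankOneSeries hρ hA _ he hρl, hphi', sub_eq_zero, eq_comm]
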